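/- Let $\ell\ge 2$ be an integer, let $W\ge 0$ be a random variable with $E[W]=1$, and let $(W_\varepsilon)$ be independent copies of $W$ indexed by the non-empty finite words $\varepsilon=\varepsilon_1\cdots\varepsilon_n$ ($n\ge1$) over the alphabet $\{0,\dots,\ell-1\}$. For such a word put $$I_{\varepsilon_1\cdots\varepsilon_n}=\Big[\sum_{k=1}^n\varepsilon_k\ell^{-k},\ \sum_{k=1}^n\varepsilon_k\ell^{-k}+\ell^{-n}\Big),$$ and let $m_n=f_n\lambda$, where $\lambda$ is Lebesgue measure on $[0,1]$ and $$f_n=\sum_{\varepsilon_1\cdots\varepsilon_n}W_{\varepsilon_1}W_{\varepsilon_1\varepsilon_2}\cdots W_{\varepsilon_1\cdots\varepsilon_n}\,\mathbf 1_{I_{\varepsilon_1\cdots\varepsilon_n}} .$$ Let $m$ be the Mandelbrot cascade associated with $W$, i.e. the (almost sure) weak limit of the random measures $m_n$ (put $m=0$ where $(m_n)$ does not converge weakly), and let $Y_\infty=m([0,1])$. With the convention $0\log 0=0$, suppose that $$0<E[Y_\infty\log Y_\infty]<+\infty .$$ Then almost surely $(m_n)$ converges weakly to $m$, the variable $W\log_\ell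 W$ is integrable and, almost surely on the event $\{m\neq 0\}$, writing $\dim$ for Hausdorff dimension: 1. there exists a Borel set $E\subseteq[0,1]$ such that $\dim(E)=1-E[W\log_\ell W]$ and $m([0,1]\setminus E)=0$; 2. for every set $F\subseteq[0,1]$ with $\dim(F)<1-E[W\log_\ell W]$, one has $m(F)=0$. Moreover, almost surely on $\{m\neq0\}$, $\dim_*(m)=\dim^*(m)=1-E[W\log_\ell W]$, where $$\dim_*(m)=\inf\{\dim(E):\ E\subseteq[0,1],\ m(E)>0\},\qquad \dim^*(m)=\inf\{\dim(E):\ E\subseteq[0,1],\ m([0,1]\setminus E)=0\},$$ and $m$ of a non-Borel set means its outer measure. -/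

import Mathlib

open MeasureTheory ProbabilityTheory Filter Topology
open scoped ENNReal

namespace MandelbrotCascade

/-- The `ℓ`-adic interval `I_{ε₁⋯εₙ} = [∑ εₖ ℓ⁻ᵏ, ∑ εₖ ℓ⁻ᵏ + ℓ⁻ⁿ)` of generation `n` coded by the
word `ε = ε₁⋯εₙ` (the letter `εₖ` is `ε (k - 1)` in the 0-based indexing of `Fin n`). -/
noncomputable def adicInterval {ℓ n : ℕ} (ε : Fin n → Fin ℓ) : Set ℝ :=
  Set.Ico (∑ k : Fin n, ((ε k : ℕ) : ℝ) / (ℓ : ℝ) ^ ((k : ℕ) + 1))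
    ((∑ k : Fin n, ((ε k : ℕ) : ℝ) / (ℓ : ℝ) ^ ((k : ℕ) + 1)) + 1 / (ℓ : ℝ) ^ n)

/-- The product `W_{ε₁} W_{ε₁ε₂} ⋯ W_{ε₁⋯εₙ}` of the weights `w` along the prefixes of the word
`ε = ε₁⋯εₙ`; finite words over the alphabet `{0, …, ℓ-1}` are lists. -/
noncomputable def weightProd {ℓ n : ℕ} (w : List (Fin ℓ) → ℝ) (ε : Fin n → Fin ℓ) : ℝ :=
  ∏ k ∈ Finset.range n, w ((List.ofFn ε).take (k + 1))

/-- The density `fₙ = ∑_{ε ∈ 𝓜ₙ} W_{ε₁} W_{ε₁ε₂} ⋯ W_{ε₁⋯εₙ} 1_{I_ε}`. -/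
noncomputable def density {ℓ : ℕ} (w : List (Fin ℓ) → ℝ) (n : ℕ) (x : ℝ) : ℝ :=
  ∑ ε : Fin n → Fin ℓ, (adicInterval ε).indicator (fun _ => weightProd w ε) x

theorem integrable_density {ℓ : ℕ} (w : List (Fin ℓ) → ℝ) (n : ℕ) :
    Integrable (density w n) (volume.restrict (Set.Icc (0 : ℝ) 1)) := by
  unfold density
  refine integrable_finsetSum _ fun ε _ => ?_
  exact (integrable_const (weightProd w ε)).indicator measurableSet_Ico

/-- The measure `mₙ = fₙ λ`, where `λ` is Lebesgue measure on `[0,1]`, seen as a finite Borel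
measure on the real line. -/
noncomputable def approx {ℓ : ℕ} (w : List (Fin ℓ) → ℝ) (n : ℕ) : FiniteMeasure ℝ :=
  ⟨(volume.restrict (Set.Icc (0 : ℝ) 1)).withDensity (fun x => ENNReal.ofReal (density w n x)),
    isFiniteMeasure_withDensity_ofReal (integrable_density w n).2⟩

open Classical in
/-- The cascade measure `m` built from the weights `w`: the weak limit of the measures `mₙ`
(topology of weak convergence on finite measures, which is Hausdorff, so that the limit is unique).
For weights for which `(mₙ)` does not converge weakly, the value is `0` by convention. -/
noncomputable def cascade {ℓ : ℕ} (w : List (Fin ℓ) → ℝ) : FiniteMeasure ℝ :=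
  if h : ∃ μ : FiniteMeasure ℝ, Tendsto (approx w) atTop (𝓝 μ) then h.choose else 0

/-- The lower dimension `dim_*(μ) = inf {dim E ; μ(E) > 0}` of a measure on `[0,1]`, where `dim` is
Hausdorff dimension. The set `E` need not be measurable: `μ E` is then its outer measure. (Every set
has a Borel superset of the same dimension, so Borel sets would give the same infimum.) -/
noncomputable def lowerDim (μ : Measure ℝ) : ℝ≥0∞ :=
  ⨅ (E : Set ℝ) (_ : E ⊆ Set.Icc 0 1) (_ : 0 < μ E), dimH E

/-- The upper dimension `dim^*(μ) = inf {dim E ; μ([0,1] \ E) = 0}` of a measure on `[0,1]`. -/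
noncomputable def upperDim (μ : Measure ℝ) : ℝ≥0∞ :=
  ⨅ (E : Set ℝ) (_ : E ⊆ Set.Icc 0 1) (_ : μ (Set.Icc 0 1 \ E) = 0), dimH E

end MandelbrotCascade

open scoped NNReal

/-!
The proof computes the local dimension of the cascade measure `m` along `ℓ`-adic intervals.

Weights are taken in `ℝ≥0` and, for most of the argument, are the coordinates of a product space
with law `weightLaw ℓ ν`, where `ν` is the law of `W`; `map_addRoot` and `ae_of_ae_weightLaw` carry
almost sure statements over to arbitrary independent copies. For a word `ε`, `shift ε w` denotes the
weights of the subtree issued from `ε`. It has the law of `w`, and apart from the weight of its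
root, which never enters its total mass, it is independent of the weights along `ε`.

* The total masses `Yₙ = mₙ([0,1])` form a non-negative martingale, hence converge almost surely
  to a limit `Y` (`totalMass`), simultaneously in all subtrees. So the masses
  `mₙ(I_ε)` converge for all `ε`, which gives the weak convergence of `mₙ` by compactness. Since
  `E[mₙ]` is Lebesgue measure, the limit has no atom at an `ℓ`-adic point, so that
  `m(I_ε) = ℓ⁻ⁿ W_{ε₁} ⋯ W_{ε₁⋯εₙ} Y(shift ε w)` (`ae_cascadeNN`), and `Y = m([0,1])`.

* By self-similarity `E[Y | ℱₙ] = E[Y] Yₙ`, so Lévy's upward theorem gives `Y = E[Y] Y`; as `Y` does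
  not vanish almost surely, `E[Y] = 1` (`integral_totalMass_eq_one`). The function `x log x` is
  superadditive and `Y` is the sum over the letters of independent products `W Y' / ℓ`, so the
  integrability of `Y log Y` entails that of `W log W`, with `E[W log W] ≤ log ℓ`
  (`integrable_mul_log`).

* Sampling a point from `m` turns the weights along its word into independent variables with the
  size-biased law `x ν(dx)`; this is the many-to-one formula `lintegral_sum_words`. By the strong
  law of large numbers the product of the weights is `exp (n (E[W log W] + o(1)))`
  (`ae_isTypical_pathProd`). By the Borel–Cantelli lemma and the integrability of `Y log Y`, the
  masses `Y` of the subtrees along the word are `exp (o(n))` (`ae_isTypical_totalMass`). Hence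
  `m(I) = ℓ^(-n (d + o(1)))` for the intervals `I` of generation `n` containing `m`-almost any given
  point, where `d = 1 - E[W log_ℓ W]` (`ae_cellMass_cascadeNN`).

* A measure with this property is carried by a Borel set of dimension `d` and charges no set of
  smaller dimension (`dimension_of_cellMass`).
-/

namespace MandelbrotCascade

/-! ### Adic cells and Hausdorff dimension -/

/-- The half-open `b`-adic interval of generation `n` with index `i : ℤ`, written as a level set
of `x ↦ ⌊x * b ^ n⌋`. -/
def cell (b n : ℕ) (i : ℤ) : Set ℝ := {x | ⌊x * (b : ℝ) ^ n⌋ = i}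

lemma cell_eq_Ico {b : ℕ} (hb : 0 < b) (n : ℕ) (i : ℤ) :
    cell b n i = Set.Ico ((i : ℝ) / (b : ℝ) ^ n) (((i : ℝ) + 1) / (b : ℝ) ^ n) := by
  have h : (0 : ℝ) < (b : ℝ) ^ n := by positivity
  ext x
  simp only [cell, Set.mem_ofPred_eq, Int.floor_eq_iff, Set.mem_Ico, div_le_iff₀ h, lt_div_iff₀ h]

lemma measurableSet_cell (b n : ℕ) (i : ℤ) : MeasurableSet (cell b n i) := by
  have : Measurable fun x : ℝ => ⌊x * (b : ℝ) ^ n⌋ := by fun_prop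
  exact this (measurableSet_singleton i)

lemma ediam_cell_le {b : ℕ} (hb : 0 < b) (n : ℕ) (i : ℤ) :
    Metric.ediam (cell b n i) ≤ ENNReal.ofReal (((b : ℝ) ^ n)⁻¹) := by
  rw [cell_eq_Ico hb, Real.ediam_Ico]
  apply ENNReal.ofReal_le_ofReal
  rw [← sub_div, add_sub_cancel_left, one_div]

/-- The mass of the `b`-adic cell of generation `n` that contains `x`. -/
noncomputable def cellMass (b : ℕ) (μ : Measure ℝ) (n : ℕ) (x : ℝ) : ℝ≥0∞ :=
  μ (cell b n ⌊x * (b : ℝ) ^ n⌋)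

lemma measurable_cellMass (b : ℕ) (μ : Measure ℝ) (n : ℕ) : Measurable (cellMass b μ n) := by
  have h : Measurable fun x : ℝ => ⌊x * (b : ℝ) ^ n⌋ := by fun_prop
  have h2 : Measurable fun i : ℤ => μ (cell b n i) := Measurable.of_discrete
  exact h2.comp h

/-- Points of `[0, 1]` all of whose cells of generation at least `N` have mass at least
`b ^ (-n s)` form a set of Hausdorff dimension at most `s`: the number of such cells of generation
`n` is at most `μ(ℝ) b ^ (n s)`. -/
lemma dimH_le_of_cellMass_ge {b : ℕ} (hb : 2 ≤ b) (μ : Measure ℝ) [IsFiniteMeasure μ]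
    {s t : ℝ} (hs : 0 ≤ s) (hst : s < t) (N : ℕ) :
    dimH {x ∈ Set.Icc (0 : ℝ) 1 | ∀ n ≥ N, ENNReal.ofReal ((b : ℝ) ^ (-(n * s))) ≤
      cellMass b μ n x} ≤ ENNReal.ofReal t := by
  have hb0 : 0 < b := by omega
  have hbR : (1 : ℝ) < b := by exact_mod_cast hb
  have hbp : (0 : ℝ) < b := by linarith
  set A := {x ∈ Set.Icc (0 : ℝ) 1 | ∀ n ≥ N, ENNReal.ofReal ((b : ℝ) ^ (-(n * s))) ≤
      cellMass b μ n x} with hA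
  have ht : 0 ≤ t := hs.trans hst.le
  classical
  let J : ℕ → Finset ℤ := fun n => (Finset.Icc (0 : ℤ) ((b : ℤ) ^ n)).filter
    fun i => ENNReal.ofReal ((b : ℝ) ^ (-(n * s))) ≤ μ (cell b n i)
  have hcard : ∀ n, ((J n).card : ℝ≥0∞) * ENNReal.ofReal ((b : ℝ) ^ (-(n * s))) ≤ μ Set.univ := by
    intro n
    calc ((J n).card : ℝ≥0∞) * ENNReal.ofReal ((b : ℝ) ^ (-(n * s)))
        = ∑ i ∈ J n, ENNReal.ofReal ((b : ℝ) ^ (-(n * s))) := by simp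
      _ ≤ ∑ i ∈ J n, μ (cell b n i) := Finset.sum_le_sum fun i hi => (Finset.mem_filter.1 hi).2
      _ = μ (⋃ i ∈ J n, cell b n i) := by
          rw [measure_biUnion_finset]
          · intro i _ j _ hij
            exact Set.disjoint_left.2 fun x hx hx' => hij (hx.symm.trans hx')
          · exact fun i _ => measurableSet_cell b n i
      _ ≤ μ Set.univ := measure_mono (Set.subset_univ _)
  have hcover : ∀ n ≥ N, A ⊆ ⋃ i : J n, cell b n i := by
    intro n hn x hx
    have hx0 : 0 ≤ x * (b : ℝ) ^ n := mul_nonneg hx.1.1 (by positivity)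
    have hx1 : x * (b : ℝ) ^ n ≤ (b : ℝ) ^ n := mul_le_of_le_one_left (by positivity) hx.1.2
    have : ⌊x * (b : ℝ) ^ n⌋ ∈ J n := by
      refine Finset.mem_filter.2 ⟨Finset.mem_Icc.2 ⟨Int.floor_nonneg.2 hx0, ?_⟩, hx.2 n hn⟩
      have := (Int.floor_le (x * (b : ℝ) ^ n)).trans hx1
      exact_mod_cast this
    exact Set.mem_iUnion.2 ⟨⟨_, this⟩, rfl⟩
  have hdiam0 : Tendsto (fun n : ℕ => ENNReal.ofReal (((b : ℝ) ^ n)⁻¹)) atTop (𝓝 0) := by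
    rw [← ENNReal.ofReal_zero]
    apply ENNReal.tendsto_ofReal
    simp_rw [← inv_pow]
    exact tendsto_pow_atTop_nhds_zero_of_lt_one (by positivity) (inv_lt_one_of_one_lt₀ hbR)
  have key := Measure.hausdorffMeasure_le_liminf_sum t A
    (fun n : ℕ => ENNReal.ofReal (((b : ℝ) ^ n)⁻¹)) hdiam0
    (fun n (i : J n) => cell b n i) (Eventually.of_forall fun n i => ediam_cell_le hb0 n i)
    (eventually_atTop.2 ⟨N, hcover⟩)
  have hsum : ∀ n : ℕ, ∑ i : J n, Metric.ediam (cell b n (i : ℤ)) ^ t ≤ μ Set.univ := by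
    intro n
    calc ∑ i : J n, Metric.ediam (cell b n (i : ℤ)) ^ t
        ≤ ∑ i : J n, ENNReal.ofReal ((b : ℝ) ^ (-(n * s))) := by
          refine Finset.sum_le_sum fun i _ => ?_
          refine (ENNReal.rpow_le_rpow (ediam_cell_le hb0 n i) ht).trans ?_
          rw [ENNReal.ofReal_rpow_of_nonneg (by positivity) ht]
          apply ENNReal.ofReal_le_ofReal
          rw [← Real.rpow_natCast, ← Real.rpow_neg hbp.le, ← Real.rpow_mul hbp.le]
          apply Real.rpow_le_rpow_of_exponent_le hbR.le
          have : (n : ℝ) * s ≤ n * t := by gcongr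
          linarith
      _ = ((J n).card : ℝ≥0∞) * ENNReal.ofReal ((b : ℝ) ^ (-(n * s))) := by simp
      _ ≤ μ Set.univ := hcard n
  have hfin : μH[t] A ≠ ∞ := by
    refine ne_top_of_le_ne_top (measure_ne_top μ Set.univ) (key.trans ?_)
    calc liminf (fun n : ℕ => ∑ i : J n, Metric.ediam (cell b n (i : ℤ)) ^ t) atTop
        ≤ liminf (fun _ : ℕ => μ Set.univ) atTop := liminf_le_liminf (Eventually.of_forall hsum)
      _ = μ Set.univ := liminf_const _
  have := dimH_le_of_hausdorffMeasure_ne_top (d := t.toNNReal) (s := A)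
    (by rwa [Real.coe_toNNReal t ht])
  exact this

/-- A set of small Hausdorff dimension carries no mass on the points whose cells of generation at
least `N` all have mass at most `b ^ (-n s)`, since a set of diameter about `b ^ (-n)` meets
at most three cells of generation `n`. -/
lemma measure_inter_eq_zero_of_cellMass_le {b : ℕ} (hb : 2 ≤ b) (μ : Measure ℝ)
    {s : ℝ} (hs : 0 < s) (N : ℕ) {F : Set ℝ} (hF : dimH F < ENNReal.ofReal s) :
    μ (F ∩ {x | ∀ n ≥ N, cellMass b μ n x ≤ ENNReal.ofReal ((b : ℝ) ^ (-(n * s)))}) = 0 := by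
  have hb0 : 0 < b := by omega
  have hbR : (1 : ℝ) < b := by exact_mod_cast hb
  have hbp : (0 : ℝ) < b := by linarith
  set G := {x | ∀ n ≥ N, cellMass b μ n x ≤ ENNReal.ofReal ((b : ℝ) ^ (-(n * s)))} with hG
  have hGm : MeasurableSet G := by
    have : G = ⋂ n ≥ N, {x | cellMass b μ n x ≤ ENNReal.ofReal ((b : ℝ) ^ (-(n * s)))} := by
      ext x; simp [hG]
    rw [this]
    exact MeasurableSet.biInter (Set.to_countable _) fun n _ =>
      measurableSet_le (measurable_cellMass b μ n) measurable_const
  -- the mass of `t ∩ G` for a set `t` of diameter at most `b ^ (-n)`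
  have hthree : ∀ n ≥ N, ∀ t : Set ℝ, Metric.ediam t ≤ ENNReal.ofReal (((b : ℝ) ^ n)⁻¹) →
      μ (t ∩ G) ≤ 3 * ENNReal.ofReal ((b : ℝ) ^ (-(n * s))) := by
    intro n hn t ht
    have hbn : (0 : ℝ) < (b : ℝ) ^ n := by positivity
    rcases (t ∩ G).eq_empty_or_nonempty with h | ⟨x₀, hx₀⟩
    · simp [h]
    set i₀ := ⌊x₀ * (b : ℝ) ^ n⌋ with hi₀
    have hcell : ∀ i : ℤ, μ (cell b n i ∩ G) ≤ ENNReal.ofReal ((b : ℝ) ^ (-(n * s))) := by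
      intro i
      rcases (cell b n i ∩ G).eq_empty_or_nonempty with h | ⟨y, hy⟩
      · simp [h]
      · have h1 := hy.2 n hn
        have h2 : ⌊y * (b : ℝ) ^ n⌋ = i := hy.1
        rw [cellMass, h2] at h1
        exact (measure_mono Set.inter_subset_left).trans h1
    have hsub : t ∩ G ⊆ (cell b n (i₀ - 1) ∩ G) ∪ (cell b n i₀ ∩ G) ∪ (cell b n (i₀ + 1) ∩ G) := by
      intro y hy
      have hd : dist y x₀ ≤ ((b : ℝ) ^ n)⁻¹ := by
        have h1 := (Metric.edist_le_ediam_of_mem hy.1 hx₀.1).trans ht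
        rw [edist_dist] at h1
        exact (ENNReal.ofReal_le_ofReal_iff (by positivity)).1 h1
      rw [Real.dist_eq] at hd
      have hd2 : |y * (b : ℝ) ^ n - x₀ * (b : ℝ) ^ n| ≤ 1 := by
        rw [← sub_mul, abs_mul, abs_of_pos hbn]
        calc |y - x₀| * (b : ℝ) ^ n ≤ ((b : ℝ) ^ n)⁻¹ * (b : ℝ) ^ n := by gcongr
          _ = 1 := inv_mul_cancel₀ hbn.ne'
      rw [abs_le] at hd2
      have h1 : ⌊y * (b : ℝ) ^ n⌋ ≤ i₀ + 1 := by
        rw [hi₀, ← Int.floor_add_one]; exact Int.floor_le_floor (by linarith)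
      have h2 : i₀ - 1 ≤ ⌊y * (b : ℝ) ^ n⌋ := by
        rw [hi₀, ← Int.floor_sub_one]; exact Int.floor_le_floor (by linarith)
      have h3 : ⌊y * (b : ℝ) ^ n⌋ = i₀ - 1 ∨ ⌊y * (b : ℝ) ^ n⌋ = i₀ ∨
        ⌊y * (b : ℝ) ^ n⌋ = i₀ + 1 := by omega
      rcases h3 with h | h | h
      · exact Or.inl (Or.inl ⟨h, hy.2⟩)
      · exact Or.inl (Or.inr ⟨h, hy.2⟩)
      · exact Or.inr ⟨h, hy.2⟩
    calc μ (t ∩ G) ≤ _ := measure_mono hsub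
      _ ≤ μ (cell b n (i₀ - 1) ∩ G) + μ (cell b n i₀ ∩ G) + μ (cell b n (i₀ + 1) ∩ G) :=
          (measure_union_le _ _).trans (by gcongr; exact measure_union_le _ _)
      _ ≤ ENNReal.ofReal ((b : ℝ) ^ (-(n * s))) + ENNReal.ofReal ((b : ℝ) ^ (-(n * s)))
          + ENNReal.ofReal ((b : ℝ) ^ (-(n * s))) := by gcongr <;> exact hcell _
      _ = 3 * ENNReal.ofReal ((b : ℝ) ^ (-(n * s))) := by ring
  have hlim : Tendsto (fun n : ℕ => 3 * ENNReal.ofReal ((b : ℝ) ^ (-(n * s)))) atTop (𝓝 0) := by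
    have h1 : Tendsto (fun n : ℕ => (b : ℝ) ^ (-(n * s))) atTop (𝓝 0) := by
      have : ∀ n : ℕ, (b : ℝ) ^ (-(n * s)) = ((b : ℝ) ^ (-s)) ^ n := by
        intro n
        rw [← Real.rpow_natCast, ← Real.rpow_mul hbp.le]; congr 1; ring
      simp_rw [this]
      exact tendsto_pow_atTop_nhds_zero_of_lt_one (by positivity)
        (Real.rpow_lt_one_of_one_lt_of_neg hbR (by linarith))
    have h2 := ENNReal.Tendsto.const_mul (a := 3) (ENNReal.tendsto_ofReal h1)
      (Or.inr (by norm_num))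
    simpa using h2
  set c : ℝ≥0∞ := 3 * ENNReal.ofReal ((b : ℝ) ^ s) with hc
  have hc0 : c ≠ 0 := by simp [hc]; positivity
  have hctop : c ≠ ∞ := by simp [hc, ENNReal.mul_eq_top]
  -- a mass distribution principle: `μ` restricted to `G` is at most `c` times the Hausdorff measure
  have hle : c⁻¹ • μ.restrict G ≤ μH[s] := by
    apply Measure.le_hausdorffMeasure s _ (ENNReal.ofReal (((b : ℝ) ^ N)⁻¹)) (by simp; positivity)
    intro t ht
    rw [Measure.smul_apply, Measure.restrict_apply' hGm, smul_eq_mul, mul_comm,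
      ← div_eq_mul_inv, ENNReal.div_le_iff hc0 hctop]
    by_cases h0 : Metric.ediam t = 0
    · have : μ (t ∩ G) ≤ 0 := ge_of_tendsto hlim (eventually_atTop.2
        ⟨N, fun n hn => hthree n hn t (by simp [h0])⟩)
      exact this.trans (by simp)
    -- choose the generation `n` with `b ^ (-(n + 1)) < diam t ≤ b ^ (-n)`
    have htop : Metric.ediam t ≠ ∞ := ne_top_of_le_ne_top ENNReal.ofReal_ne_top ht
    set r := (Metric.ediam t).toReal with hr
    have hr0 : 0 < r := ENNReal.toReal_pos h0 htop
    have hrt : Metric.ediam t = ENNReal.ofReal r := (ENNReal.ofReal_toReal htop).symm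
    have hrN : r ≤ ((b : ℝ) ^ N)⁻¹ := by
      rw [hrt] at ht; exact (ENNReal.ofReal_le_ofReal_iff (by positivity)).1 ht
    have hex : ∃ n : ℕ, ((b : ℝ) ^ n)⁻¹ < r := by
      obtain ⟨n, hn⟩ := exists_pow_lt_of_lt_one hr0 (inv_lt_one_of_one_lt₀ hbR)
      exact ⟨n, by rwa [inv_pow] at hn⟩
    classical
    have hfind := Nat.find_spec hex
    have hgt : N < Nat.find hex := by
      by_contra! hcon
      have : ((b : ℝ) ^ N)⁻¹ ≤ ((b : ℝ) ^ (Nat.find hex))⁻¹ := by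
        gcongr; exact hbR.le
      linarith
    obtain ⟨n, hn⟩ : ∃ n, Nat.find hex = n + 1 := ⟨Nat.find hex - 1, by omega⟩
    have hmin : r ≤ ((b : ℝ) ^ n)⁻¹ := not_lt.1 (Nat.find_min hex (m := n) (by omega))
    rw [hn] at hfind
    refine (hthree n (by omega) t (by rw [hrt]; exact ENNReal.ofReal_le_ofReal hmin)).trans ?_
    rw [hrt, ENNReal.ofReal_rpow_of_nonneg hr0.le hs.le, hc, mul_left_comm,
      ← ENNReal.ofReal_mul (by positivity)]
    gcongr
    rw [← Real.mul_rpow hr0.le hbp.le]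
    have h5 : ((b : ℝ) ^ n)⁻¹ ≤ r * b := by
      have : ((b : ℝ) ^ n)⁻¹ = ((b : ℝ) ^ (n + 1))⁻¹ * b := by
        rw [pow_succ]; field_simp
      rw [this]; gcongr
    calc (b : ℝ) ^ (-(n * s)) = (((b : ℝ) ^ n)⁻¹) ^ s := by
          rw [← Real.rpow_natCast, ← Real.rpow_neg hbp.le, ← Real.rpow_mul hbp.le]; congr 1; ring
      _ ≤ (r * b) ^ s := Real.rpow_le_rpow (by positivity) h5 hs.le
  have hFs : μH[s] F = 0 := by
    have := hausdorffMeasure_of_dimH_lt (s := F) (d := s.toNNReal) hF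
    rwa [Real.coe_toNNReal s hs.le] at this
  have h0 : (c⁻¹ • μ.restrict G) F = 0 := le_antisymm ((hle F).trans hFs.le) bot_le
  rw [Measure.smul_apply, Measure.restrict_apply' hGm, smul_eq_mul] at h0
  rcases mul_eq_zero.1 h0 with h | h
  · exact absurd h (ENNReal.inv_ne_zero.2 hctop)
  · exact h

/-- A finite measure on `[0, 1]` whose local dimension along `b`-adic cells is almost everywhere
`d` is carried by a Borel set of dimension `d` and charges no set of smaller dimension. -/
theorem dimension_of_cellMass {b : ℕ} (hb : 2 ≤ b) (μ : Measure ℝ) [IsFiniteMeasure μ]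
    (hμ : μ (Set.Icc 0 1)ᶜ = 0) (hμ0 : μ ≠ 0) {d : ℝ} (hd : 0 ≤ d)
    (h : ∀ δ > 0, ∀ᵐ x ∂μ, ∀ᶠ n : ℕ in atTop,
      ENNReal.ofReal ((b : ℝ) ^ (-(n * (d + δ)))) ≤ cellMass b μ n x ∧
      cellMass b μ n x ≤ ENNReal.ofReal ((b : ℝ) ^ (-(n * (d - δ))))) :
    (∃ E : Set ℝ, MeasurableSet E ∧ E ⊆ Set.Icc 0 1 ∧ (dimH E : EReal) = (d : EReal) ∧
        μ (Set.Icc 0 1 \ E) = 0) ∧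
      (∀ F : Set ℝ, F ⊆ Set.Icc 0 1 → (dimH F : EReal) < (d : EReal) → μ F = 0) ∧
      (lowerDim μ : EReal) = (d : EReal) ∧ (upperDim μ : EReal) = (d : EReal) := by
  have hdcoe : (d : EReal) = ((ENNReal.ofReal d : ℝ≥0∞) : EReal) := by
    rw [EReal.coe_ennreal_ofReal, max_eq_left hd]
  rw [hdcoe]
  simp only [EReal.coe_ennreal_lt_coe_ennreal_iff, EReal.coe_ennreal_eq_coe_ennreal_iff]
  have hsmall : ∀ F : Set ℝ, dimH F < ENNReal.ofReal d → μ F = 0 := by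
    intro F hF
    obtain ⟨r, hFr, hrd⟩ := exists_between hF
    have hrtop : r ≠ ∞ := hrd.ne_top
    obtain ⟨s, rfl⟩ : ∃ s : ℝ, r = ENNReal.ofReal s :=
      ⟨r.toReal, (ENNReal.ofReal_toReal hrtop).symm⟩
    have hs : 0 < s := ENNReal.ofReal_pos.1 (bot_le.trans_lt hFr)
    have hsd : s < d := (ENNReal.ofReal_lt_ofReal_iff_of_nonneg hs.le).1 hrd
    have h1 := h (d - s) (by linarith)
    have h2 : ∀ N : ℕ, μ (F ∩ {x | ∀ n ≥ N, cellMass b μ n x ≤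
        ENNReal.ofReal ((b : ℝ) ^ (-(n * s)))}) = 0 :=
      fun N => measure_inter_eq_zero_of_cellMass_le hb μ hs N hFr
    have h3 := measure_iUnion_null h2
    refine measure_mono_null ?_ (measure_union_null h3 h1)
    intro x hx
    by_cases hx2 : ∀ᶠ n : ℕ in atTop,
      ENNReal.ofReal ((b : ℝ) ^ (-(n * (d + (d - s))))) ≤ cellMass b μ n x ∧
      cellMass b μ n x ≤ ENNReal.ofReal ((b : ℝ) ^ (-(n * (d - (d - s)))))
    · obtain ⟨N, hN⟩ := eventually_atTop.1 hx2
      refine Or.inl (Set.mem_iUnion.2 ⟨N, hx, fun n hn => ?_⟩)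
      have := (hN n hn).2
      rwa [sub_sub_cancel] at this
    · exact Or.inr hx2
  -- `E` below is the set of points of `[0, 1]` where the upper local dimension is at most `d`
  let A : ℕ → ℕ → Set ℝ := fun k N => {x ∈ Set.Icc (0 : ℝ) 1 | ∀ n ≥ N,
    ENNReal.ofReal ((b : ℝ) ^ (-(n * (d + 1 / ((k : ℝ) + 1))))) ≤ cellMass b μ n x}
  have hAm : ∀ k N, MeasurableSet (A k N) := by
    intro k N
    have : A k N = Set.Icc 0 1 ∩ ⋂ n ≥ N, {x | ENNReal.ofReal
        ((b : ℝ) ^ (-(n * (d + 1 / ((k : ℝ) + 1))))) ≤ cellMass b μ n x} := by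
      ext x; simp [A]
    rw [this]
    exact measurableSet_Icc.inter (MeasurableSet.biInter (Set.to_countable _) fun n _ =>
      measurableSet_le measurable_const (measurable_cellMass b μ n))
  set E : Set ℝ := ⋂ k, ⋃ N, A k N with hE
  have hEsub : E ⊆ Set.Icc 0 1 := fun x hx => by
    obtain ⟨N, hN⟩ := Set.mem_iUnion.1 (Set.mem_iInter.1 hx 0)
    exact hN.1
  have hEm : MeasurableSet E := MeasurableSet.iInter fun k => MeasurableSet.iUnion fun N => hAm k N
  have hEdim : dimH E ≤ ENNReal.ofReal d := by
    have h1 : ∀ k : ℕ, dimH E ≤ ENNReal.ofReal (d + 2 * (1 / ((k : ℝ) + 1))) := by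
      intro k
      have hk : (0 : ℝ) < 1 / ((k : ℝ) + 1) := by positivity
      refine (dimH_mono (Set.iInter_subset _ k)).trans ?_
      rw [dimH_iUnion]
      exact iSup_le fun N => dimH_le_of_cellMass_ge hb μ (by linarith) (by linarith) N
    have h2 : Tendsto (fun k : ℕ => ENNReal.ofReal (d + 2 * (1 / ((k : ℝ) + 1)))) atTop
        (𝓝 (ENNReal.ofReal (d + 2 * 0))) :=
      ENNReal.tendsto_ofReal ((tendsto_one_div_add_atTop_nhds_zero_nat.const_mul 2).const_add d)
    rw [mul_zero, add_zero] at h2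
    exact ge_of_tendsto' h2 h1
  have hEfull : μ (Set.Icc 0 1 \ E) = 0 := by
    have h1 : ∀ᵐ x ∂μ, ∀ k : ℕ, ∀ᶠ n : ℕ in atTop,
        ENNReal.ofReal ((b : ℝ) ^ (-(n * (d + 1 / ((k : ℝ) + 1))))) ≤ cellMass b μ n x :=
      ae_all_iff.2 fun k => (h _ (by positivity)).mono fun x hx => hx.mono fun n hn => hn.1
    refine measure_mono_null ?_ h1
    rintro x ⟨hx1, hx2⟩ hx3
    refine hx2 (Set.mem_iInter.2 fun k => ?_)
    obtain ⟨N, hN⟩ := eventually_atTop.1 (hx3 k)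
    exact Set.mem_iUnion.2 ⟨N, hx1, hN⟩
  have hIcc : μ (Set.Icc 0 1) ≠ 0 := fun h0 => hμ0 <| by
    rw [← Measure.measure_univ_eq_zero, ← Set.union_compl_self (Set.Icc (0 : ℝ) 1)]
    exact measure_union_null h0 hμ
  have hfullpos : ∀ E' : Set ℝ, μ (Set.Icc 0 1 \ E') = 0 → μ E' ≠ 0 := fun E' h1 h2 => hIcc <|
    measure_mono_null (fun x hx => by by_cases hx' : x ∈ E' <;> simp_all) (measure_union_null h1 h2)
  have hge : ∀ E' : Set ℝ, μ E' ≠ 0 → ENNReal.ofReal d ≤ dimH E' := fun E' h1 =>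
    not_lt.1 fun h2 => h1 (hsmall E' h2)
  have hEeq : dimH E = ENNReal.ofReal d := le_antisymm hEdim (hge E (hfullpos E hEfull))
  refine ⟨⟨E, hEm, hEsub, hEeq, hEfull⟩, fun F _ hF => hsmall F hF, le_antisymm ?_ ?_,
    le_antisymm ?_ ?_⟩
  · exact (iInf₂_le E hEsub).trans ((iInf_le _ (pos_iff_ne_zero.2 (hfullpos E hEfull))).trans hEdim)
  · exact le_iInf₂ fun E' _ => le_iInf fun h1 => hge E' h1.ne'
  · exact (iInf₂_le E hEsub).trans ((iInf_le _ hEfull).trans hEdim)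
  · exact le_iInf₂ fun E' _ => le_iInf fun h1 => hge E' (hfullpos E' h1)

/-! ### Words, adic intervals and the approximations of the cascade -/

/-- The words of length `n` over the alphabet `{0, …, ℓ - 1}`, as a finset of lists. -/
def words (ℓ n : ℕ) : Finset (List (Fin ℓ)) :=
  Finset.univ.map ⟨fun ε : Fin n → Fin ℓ => List.ofFn ε, List.ofFn_injective⟩

lemma mem_words {ℓ n : ℕ} {ε : List (Fin ℓ)} : ε ∈ words ℓ n ↔ ε.length = n := by
  simp only [words, Finset.mem_map, Finset.mem_univ, true_and, Function.Embedding.coeFn_mk]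
  constructor
  · rintro ⟨f, rfl⟩; simp
  · rintro rfl; exact ⟨ε.get, List.ofFn_get ε⟩

lemma card_words (ℓ n : ℕ) : (words ℓ n).card = ℓ ^ n := by
  simp [words]

lemma sum_words {M : Type*} [AddCommMonoid M] (ℓ n : ℕ) (g : List (Fin ℓ) → M) :
    ∑ ε ∈ words ℓ n, g ε = ∑ ε : Fin n → Fin ℓ, g (List.ofFn ε) := by
  simp [words]

lemma sum_words_add {M : Type*} [AddCommMonoid M] (ℓ n p : ℕ) (g : List (Fin ℓ) → M) :
    ∑ ε ∈ words ℓ (n + p), g ε = ∑ ε ∈ words ℓ n, ∑ η ∈ words ℓ p, g (ε ++ η) := by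
  rw [Finset.sum_sigma']
  refine Finset.sum_bij' (fun ε _ => ⟨ε.take n, ε.drop n⟩) (fun x _ => x.1 ++ x.2) ?_ ?_ ?_ ?_ ?_
  · intro ε hε
    rw [mem_words] at hε
    simp [mem_words, hε]
  · rintro ⟨a, b⟩ h
    simp only [Finset.mem_sigma, mem_words] at h
    simp [mem_words, h.1, h.2]
  · intro ε _; simp
  · rintro ⟨a, b⟩ h
    simp only [Finset.mem_sigma, mem_words] at h
    simp [← h.1]
  · intro ε _; simp

/-- The `ℓ`-adic interval coded by a word, in recursive form: `x` lies in the interval of `j :: η`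
if and only if `ℓ x - j` lies in that of `η`. -/
def ival {ℓ : ℕ} : List (Fin ℓ) → Set ℝ
  | [] => Set.Ico 0 1
  | j :: η => {x | (ℓ : ℝ) * x - (j : ℕ) ∈ ival η}

lemma adicInterval_eq_ival {ℓ : ℕ} (hℓ : 0 < ℓ) {n : ℕ} (ε : Fin n → Fin ℓ) :
    adicInterval ε = ival (List.ofFn ε) := by
  have hp : (0 : ℝ) < ℓ := by exact_mod_cast hℓ
  induction n with
  | zero => simp [adicInterval, ival]
  | succ n ih =>
    rw [List.ofFn_succ, ival, ← ih (fun i => ε i.succ)]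
    ext x
    have hS : ∑ k : Fin (n + 1), ((ε k : ℕ) : ℝ) / (ℓ : ℝ) ^ ((k : ℕ) + 1)
        = (((ε 0 : ℕ) : ℝ) + ∑ k : Fin n, ((ε k.succ : ℕ) : ℝ) / (ℓ : ℝ) ^ ((k : ℕ) + 1)) / ℓ := by
      rw [Fin.sum_univ_succ, add_div, Finset.sum_div]
      congr 1
      · simp
      · refine Finset.sum_congr rfl fun k _ => ?_
        rw [Fin.val_succ, pow_succ _ ((k : ℕ) + 1), div_div]
    have h1 : 1 / (ℓ : ℝ) ^ (n + 1) = 1 / (ℓ : ℝ) ^ n / ℓ := by rw [pow_succ, div_div]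
    simp only [adicInterval, Set.mem_Ico, Set.mem_ofPred_eq]
    rw [hS, h1, ← add_div, div_le_iff₀ hp, lt_div_iff₀ hp]
    constructor <;> rintro ⟨h1, h2⟩ <;> constructor <;> linarith

lemma exists_ival_eq_cell {ℓ : ℕ} (ε : List (Fin ℓ)) :
    ∃ a : ℤ, ival ε = cell ℓ ε.length a := by
  induction ε with
  | nil => exact ⟨0, by ext x; simp [ival, cell, Int.floor_eq_iff]⟩
  | cons j η ih =>
    obtain ⟨a, ha⟩ := ih
    refine ⟨a + ((j : ℕ) * ℓ ^ η.length : ℕ), ?_⟩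
    ext x
    rw [ival, ha]
    simp only [cell, Set.mem_ofPred_eq, List.length_cons]
    have : ((ℓ : ℝ) * x - (j : ℕ)) * (ℓ : ℝ) ^ η.length
        = x * (ℓ : ℝ) ^ (η.length + 1) - (((j : ℕ) * ℓ ^ η.length : ℕ) : ℤ) := by
      push_cast; ring
    rw [this, Int.floor_sub_intCast, sub_eq_iff_eq_add]

lemma measurableSet_ival {ℓ : ℕ} (ε : List (Fin ℓ)) : MeasurableSet (ival ε) := by
  obtain ⟨a, ha⟩ := exists_ival_eq_cell ε
  rw [ha]; exact measurableSet_cell _ _ _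

lemma ival_subset {ℓ : ℕ} (ε : List (Fin ℓ)) : ival ε ⊆ Set.Ico 0 1 := by
  induction ε with
  | nil => exact subset_rfl
  | cons j η ih =>
    intro x hx
    have h := ih hx
    have hj : ((j : ℕ) : ℝ) + 1 ≤ ℓ := by exact_mod_cast j.2
    have hj0 : (0 : ℝ) ≤ (j : ℕ) := by positivity
    have hp : (0 : ℝ) < ℓ := by linarith
    constructor
    · by_contra! hneg
      nlinarith [h.1, h.2]
    · by_contra! hneg
      nlinarith [h.1, h.2]

lemma ival_append_subset {ℓ : ℕ} (ε η : List (Fin ℓ)) : ival (ε ++ η) ⊆ ival ε := by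
  induction ε with
  | nil => exact ival_subset η
  | cons j ε ih => exact fun x hx => ih hx

lemma eq_of_mem_ival {ℓ : ℕ} {ε η : List (Fin ℓ)} (h : ε.length = η.length) {x : ℝ}
    (hε : x ∈ ival ε) (hη : x ∈ ival η) : ε = η := by
  induction ε generalizing η x with
  | nil => exact (List.length_eq_zero_iff.1 h.symm).symm
  | cons i ε ih =>
    cases η with
    | nil => simp at h
    | cons j η =>
      have h1 := ival_subset _ hε
      have h2 := ival_subset _ hη
      have hij : (i : ℕ) = j := by
        have a := ival_subset _ (show (ℓ : ℝ) * x - (i : ℕ) ∈ ival ε from hε)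
        have b := ival_subset _ (show (ℓ : ℝ) * x - (j : ℕ) ∈ ival η from hη)
        have c : ((i : ℕ) : ℝ) < (j : ℕ) + 1 := by linarith [a.1, b.2]
        have d : ((j : ℕ) : ℝ) < (i : ℕ) + 1 := by linarith [a.2, b.1]
        have c' : (i : ℕ) < (j : ℕ) + 1 := by exact_mod_cast c
        have d' : (j : ℕ) < (i : ℕ) + 1 := by exact_mod_cast d
        omega
      obtain rfl : i = j := Fin.ext hij
      rw [ih (by simpa using h) hε hη]

lemma exists_mem_ival {ℓ : ℕ} (hℓ : 0 < ℓ) (n : ℕ) {x : ℝ} (hx : x ∈ Set.Ico (0 : ℝ) 1) :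
    ∃ ε ∈ words ℓ n, x ∈ ival ε := by
  have hp : (0 : ℝ) < ℓ := by exact_mod_cast hℓ
  induction n generalizing x with
  | zero => exact ⟨[], by simp [mem_words], hx⟩
  | succ n ih =>
    have h0 : 0 ≤ (ℓ : ℝ) * x := mul_nonneg hp.le hx.1
    have hlt : ⌊(ℓ : ℝ) * x⌋₊ < ℓ := by
      rw [Nat.floor_lt h0]
      nlinarith [hx.2]
    obtain ⟨η, hη, hxη⟩ := ih (x := (ℓ : ℝ) * x - (⌊(ℓ : ℝ) * x⌋₊ : ℕ))
      ⟨by linarith [Nat.floor_le h0], by linarith [Nat.lt_floor_add_one ((ℓ : ℝ) * x)]⟩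
    refine ⟨⟨_, hlt⟩ :: η, ?_, hxη⟩
    rw [mem_words] at hη ⊢
    simp [hη]

lemma disjoint_ival {ℓ : ℕ} {ε η : List (Fin ℓ)} (h : ε.length = η.length) (hne : ε ≠ η) :
    Disjoint (ival ε) (ival η) :=
  Set.disjoint_left.2 fun _ h1 h2 => hne (eq_of_mem_ival h h1 h2)

lemma iUnion_ival {ℓ : ℕ} (hℓ : 0 < ℓ) (n : ℕ) :
    ⋃ ε ∈ words ℓ n, ival ε = Set.Ico (0 : ℝ) 1 := by
  apply subset_antisymm
  · exact Set.iUnion₂_subset fun ε _ => ival_subset ε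
  · intro x hx
    obtain ⟨ε, h1, h2⟩ := exists_mem_ival hℓ n hx
    exact Set.mem_iUnion₂.2 ⟨ε, h1, h2⟩

lemma sum_measure_ival_inter {ℓ : ℕ} (hℓ : 0 < ℓ) (μ : Measure ℝ) (n : ℕ) {B : Set ℝ}
    (hB : MeasurableSet B) :
    ∑ ε ∈ words ℓ n, μ (ival ε ∩ B) = μ (Set.Ico 0 1 ∩ B) := by
  rw [← iUnion_ival hℓ n, Set.iUnion₂_inter, measure_biUnion_finset]
  · intro ε hε η hη hne
    exact (disjoint_ival ((mem_words.1 hε).trans (mem_words.1 hη).symm) hne).mono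
      Set.inter_subset_left Set.inter_subset_left
  · exact fun ε _ => (measurableSet_ival ε).inter hB

lemma sum_measure_ival {ℓ : ℕ} (hℓ : 0 < ℓ) (μ : Measure ℝ) (n : ℕ) :
    ∑ ε ∈ words ℓ n, μ (ival ε) = μ (Set.Ico 0 1) := by
  simpa using sum_measure_ival_inter hℓ μ n MeasurableSet.univ

lemma volume_ival {ℓ : ℕ} (hℓ : 0 < ℓ) (ε : List (Fin ℓ)) :
    volume (ival ε) = ((ℓ : ℝ≥0∞) ^ ε.length)⁻¹ := by
  obtain ⟨a, ha⟩ := exists_ival_eq_cell ε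
  rw [ha, cell_eq_Ico hℓ, Real.volume_Ico, ← sub_div, add_sub_cancel_left, one_div,
    ENNReal.ofReal_inv_of_pos (by positivity), ENNReal.ofReal_pow (by positivity),
    ENNReal.ofReal_natCast]

/-- The subtree of weights issued from the word `ε`. -/
def shift {ℓ : ℕ} {α : Type*} (ε : List (Fin ℓ)) (w : List (Fin ℓ) → α) : List (Fin ℓ) → α :=
  fun η => w (ε ++ η)

@[simp] lemma shift_nil {ℓ : ℕ} {α : Type*} (w : List (Fin ℓ) → α) : shift [] w = w := rfl

/-- The product of the weights along the non-empty prefixes of a word. -/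
noncomputable def pathProd {ℓ : ℕ} (w : List (Fin ℓ) → ℝ≥0) (ε : List (Fin ℓ)) : ℝ≥0 :=
  ∏ k ∈ Finset.range ε.length, w (ε.take (k + 1))

@[simp] lemma pathProd_nil {ℓ : ℕ} (w : List (Fin ℓ) → ℝ≥0) : pathProd w [] = 1 := by
  simp [pathProd]

lemma pathProd_append {ℓ : ℕ} (w : List (Fin ℓ) → ℝ≥0) (ε η : List (Fin ℓ)) :
    pathProd w (ε ++ η) = pathProd w ε * pathProd (shift ε w) η := by
  rw [pathProd, List.length_append, Finset.prod_range_add]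
  congr 1
  · refine Finset.prod_congr rfl fun k hk => ?_
    rw [List.take_append_of_le_length (Finset.mem_range.1 hk)]
  · refine Finset.prod_congr rfl fun k _ => ?_
    rw [shift, add_assoc, List.take_length_add_append]

lemma weightProd_coe {ℓ n : ℕ} (w : List (Fin ℓ) → ℝ≥0) (ε : Fin n → Fin ℓ) :
    weightProd (fun η => (w η : ℝ)) ε = pathProd w (List.ofFn ε) := by
  simp [weightProd, pathProd]

/-- The total mass of the `n`-th approximation of the cascade. -/
noncomputable def partialMass {ℓ : ℕ} (n : ℕ) (w : List (Fin ℓ) → ℝ≥0) : ℝ≥0 :=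
  ∑ ε ∈ words ℓ n, pathProd w ε / (ℓ : ℝ≥0) ^ n

lemma partialMass_add {ℓ : ℕ} (n p : ℕ) (w : List (Fin ℓ) → ℝ≥0) :
    partialMass (n + p) w =
      ∑ ε ∈ words ℓ n, pathProd w ε / (ℓ : ℝ≥0) ^ n * partialMass p (shift ε w) := by
  rw [partialMass, sum_words_add]
  refine Finset.sum_congr rfl fun ε _ => ?_
  rw [partialMass, Finset.mul_sum]
  refine Finset.sum_congr rfl fun η _ => ?_
  rw [pathProd_append, div_mul_div_comm, pow_add]

/-- The `n`-th approximation of the cascade with non-negative weights `w`. -/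
noncomputable abbrev approxNN {ℓ : ℕ} (w : List (Fin ℓ) → ℝ≥0) (n : ℕ) : FiniteMeasure ℝ :=
  approx (fun ε => (w ε : ℝ)) n

lemma approxNN_apply {ℓ : ℕ} (hℓ : 0 < ℓ) (w : List (Fin ℓ) → ℝ≥0) (n : ℕ) {B : Set ℝ}
    (hB : MeasurableSet B) :
    (approxNN w n : Measure ℝ) B =
      ∑ ε ∈ words ℓ n, (pathProd w ε : ℝ≥0∞) * volume (ival ε ∩ B) := by
  have hdens : ∀ x, ENNReal.ofReal (density (fun ε => (w ε : ℝ)) n x)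
      = ∑ ε ∈ words ℓ n, (ival ε).indicator (fun _ => (pathProd w ε : ℝ≥0∞)) x := by
    intro x
    rw [density, sum_words, ENNReal.ofReal_sum_of_nonneg]
    · refine Finset.sum_congr rfl fun ε _ => ?_
      rw [adicInterval_eq_ival hℓ, weightProd_coe]
      by_cases hx : x ∈ ival (List.ofFn ε) <;> simp [hx]
    · intro ε _
      rw [weightProd_coe]
      exact Set.indicator_nonneg (fun _ _ => by positivity) x
  change ((volume.restrict (Set.Icc (0 : ℝ) 1)).withDensity
    (fun x => ENNReal.ofReal (density (fun ε => (w ε : ℝ)) n x))) B = _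
  rw [withDensity_apply _ hB]
  simp_rw [hdens]
  rw [lintegral_finsetSum _ fun ε _ => (measurable_const.indicator (measurableSet_ival ε))]
  refine Finset.sum_congr rfl fun ε _ => ?_
  rw [lintegral_indicator_const (measurableSet_ival ε),
    Measure.restrict_apply (measurableSet_ival ε), Measure.restrict_apply
      ((measurableSet_ival ε).inter hB), Set.inter_eq_left.2]
  exact fun x hx => Set.Ico_subset_Icc_self (ival_subset ε hx.1)

lemma approxNN_compl {ℓ : ℕ} (hℓ : 0 < ℓ) (w : List (Fin ℓ) → ℝ≥0) (n : ℕ) :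
    (approxNN w n : Measure ℝ) (Set.Ico 0 1)ᶜ = 0 := by
  rw [approxNN_apply hℓ w n measurableSet_Ico.compl]
  refine Finset.sum_eq_zero fun ε _ => ?_
  rw [Set.disjoint_iff_inter_eq_empty.1 (Set.disjoint_compl_right_iff_subset.2 (ival_subset ε))]
  simp

lemma approxNN_ival {ℓ : ℕ} (hℓ : 0 < ℓ) (w : List (Fin ℓ) → ℝ≥0) (p : ℕ) (ε : List (Fin ℓ)) :
    (approxNN w (ε.length + p) : Measure ℝ) (ival ε) =
      ((pathProd w ε / (ℓ : ℝ≥0) ^ ε.length * partialMass p (shift ε w) : ℝ≥0) : ℝ≥0∞) := by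
  have hℓ0 : (ℓ : ℝ≥0) ≠ 0 := by exact_mod_cast hℓ.ne'
  rw [approxNN_apply hℓ w _ (measurableSet_ival ε), sum_words_add,
    Finset.sum_eq_single_of_mem ε (mem_words.2 rfl)]
  · rw [partialMass, Finset.mul_sum, ENNReal.ofNNReal_finsetSum]
    refine Finset.sum_congr rfl fun η hη => ?_
    rw [Set.inter_eq_left.2 (ival_append_subset ε η), volume_ival hℓ, pathProd_append,
      List.length_append, mem_words.1 hη, div_mul_div_comm, ← pow_add,
      ENNReal.coe_div (pow_ne_zero _ hℓ0), div_eq_mul_inv]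
    simp
  · intro δ hδ hne
    refine Finset.sum_eq_zero fun η _ => ?_
    have : ival (δ ++ η) ∩ ival ε = ∅ := Set.disjoint_iff_inter_eq_empty.1
      ((disjoint_ival (mem_words.1 hδ) hne).mono_left (ival_append_subset δ η))
    simp [this]

lemma approxNN_univ {ℓ : ℕ} (hℓ : 0 < ℓ) (w : List (Fin ℓ) → ℝ≥0) (n : ℕ) :
    (approxNN w n : Measure ℝ) Set.univ = partialMass n w := by
  have h := approxNN_ival hℓ w n []
  simp only [List.length_nil, zero_add, ival, pathProd_nil, pow_zero, div_one, one_mul,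
    shift_nil] at h
  rw [← h, ← measure_add_measure_compl (measurableSet_Ico (a := (0 : ℝ)) (b := 1)),
    approxNN_compl hℓ, add_zero]

/-! ### Weak convergence of the approximations -/

lemma dist_le_of_mem_ival {ℓ : ℕ} (hℓ : 0 < ℓ) {ε : List (Fin ℓ)} {x y : ℝ} (hx : x ∈ ival ε)
    (hy : y ∈ ival ε) : dist x y ≤ ((ℓ : ℝ) ^ ε.length)⁻¹ := by
  obtain ⟨a, ha⟩ := exists_ival_eq_cell ε
  rw [ha] at hx hy
  have h := (Metric.edist_le_ediam_of_mem hx hy).trans (ediam_cell_le hℓ _ a)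
  rw [edist_dist] at h
  exact (ENNReal.ofReal_le_ofReal_iff (by positivity)).1 h

/-- If the masses of all `ℓ`-adic intervals converge then so do the integrals of bounded
continuous functions, by uniform approximation with step functions. -/
lemma exists_tendsto_integral {ℓ : ℕ} (hℓ : 2 ≤ ℓ) (μ : ℕ → FiniteMeasure ℝ)
    (hμ : ∀ n, (μ n : Measure ℝ) (Set.Ico 0 1)ᶜ = 0) {C : ℝ}
    (hC : ∀ n, (μ n : Measure ℝ).real Set.univ ≤ C)
    (h : ∀ ε : List (Fin ℓ), ∃ c : ℝ,
      Tendsto (fun n => (μ n : Measure ℝ).real (ival ε)) atTop (𝓝 c))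
    (f : BoundedContinuousFunction ℝ ℝ) :
    ∃ L : ℝ, Tendsto (fun n => ∫ x, f x ∂(μ n : Measure ℝ)) atTop (𝓝 L) := by
  have hℓ0 : 0 < ℓ := by omega
  have hC0 : 0 ≤ C := measureReal_nonneg.trans (hC 0)
  apply cauchySeq_tendsto_of_complete
  rw [Metric.cauchySeq_iff]
  intro η hη
  set κ : ℝ := η / (4 * (C + 1)) with hκ
  have hκ0 : 0 < κ := by positivity
  have huc : UniformContinuousOn f (Set.Icc 0 1) :=
    isCompact_Icc.uniformContinuousOn_of_continuous f.continuous.continuousOn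
  obtain ⟨δ, hδ, hfδ⟩ := Metric.uniformContinuousOn_iff.1 huc κ hκ0
  obtain ⟨k, hk⟩ : ∃ k : ℕ, ((ℓ : ℝ)⁻¹) ^ k < δ :=
    exists_pow_lt_of_lt_one hδ (inv_lt_one_of_one_lt₀ (by exact_mod_cast hℓ))
  rw [inv_pow] at hk
  classical
  let pt : List (Fin ℓ) → ℝ := fun ε => if hne : (ival ε).Nonempty then hne.some else 0
  have hpt : ∀ ε ∈ words ℓ k, ∀ y ∈ ival ε, ‖f y - f (pt ε)‖ ≤ κ := by
    intro ε hε y hy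
    have hne : (ival ε).Nonempty := ⟨y, hy⟩
    have hp : pt ε ∈ ival ε := by simp only [pt, hne, dite_true]; exact hne.some_mem
    rw [← dist_eq_norm]
    refine (hfδ y (Set.Ico_subset_Icc_self (ival_subset _ hy)) _
      (Set.Ico_subset_Icc_self (ival_subset _ hp)) ?_).le
    refine (dist_le_of_mem_ival hℓ0 hy hp).trans_lt ?_
    rwa [mem_words.1 hε]
  let b : ℕ → ℝ := fun n => ∑ ε ∈ words ℓ k, f (pt ε) * (μ n : Measure ℝ).real (ival ε)
  have hb : CauchySeq b := by
    choose c hc using h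
    exact (tendsto_finsetSum _ fun ε _ => (hc ε).const_mul (f (pt ε))).cauchySeq
  have hab : ∀ n, |∫ x, f x ∂(μ n : Measure ℝ) - b n| ≤ η / 4 := by
    intro n
    have hfi : Integrable f (μ n : Measure ℝ) := f.integrable _
    have h1 : ∫ x, f x ∂(μ n : Measure ℝ) =
        ∑ ε ∈ words ℓ k, ∫ x in ival ε, f x ∂(μ n : Measure ℝ) := by
      rw [← integral_biUnion_finset _ (fun ε _ => measurableSet_ival ε)
        (fun ε hε δ hδ hne => disjoint_ival ((mem_words.1 hε).trans (mem_words.1 hδ).symm) hne)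
        (fun ε _ => hfi.integrableOn), iUnion_ival hℓ0, Measure.restrict_eq_self_of_ae_mem]
      exact hμ n
    have h2 : ∑ ε ∈ words ℓ k, (μ n : Measure ℝ).real (ival ε) ≤ C := by
      have := sum_measure_ival hℓ0 (μ n : Measure ℝ) k
      simp only [Measure.real]
      rw [← ENNReal.toReal_sum (fun ε _ => measure_ne_top _ _), this]
      exact (measureReal_mono (Set.subset_univ _)).trans (hC n)
    have h3 : ∀ ε ∈ words ℓ k, |∫ x in ival ε, f x ∂(μ n : Measure ℝ)
        - f (pt ε) * (μ n : Measure ℝ).real (ival ε)| ≤ κ * (μ n : Measure ℝ).real (ival ε) := by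
      intro ε hε
      have : ∫ x in ival ε, f x ∂(μ n : Measure ℝ) - f (pt ε) * (μ n : Measure ℝ).real (ival ε)
          = ∫ x in ival ε, (f x - f (pt ε)) ∂(μ n : Measure ℝ) := by
        rw [integral_sub hfi.integrableOn (integrable_const _), setIntegral_const, smul_eq_mul,
          mul_comm]
      rw [this, ← Real.norm_eq_abs]
      exact norm_setIntegral_le_of_norm_le_const (measure_lt_top _ _) (hpt ε hε)
    rw [h1, ← Finset.sum_sub_distrib]
    calc _ ≤ ∑ ε ∈ words ℓ k, κ * (μ n : Measure ℝ).real (ival ε) :=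
          (Finset.abs_sum_le_sum_abs _ _).trans (Finset.sum_le_sum h3)
      _ = κ * ∑ ε ∈ words ℓ k, (μ n : Measure ℝ).real (ival ε) := by rw [Finset.mul_sum]
      _ ≤ κ * (C + 1) := by gcongr; linarith
      _ = η / 4 := by rw [hκ]; field_simp
  obtain ⟨N, hN⟩ := Metric.cauchySeq_iff.1 hb (η / 2) (by positivity)
  refine ⟨N, fun m hm n hn => ?_⟩
  have h1 := hN m hm n hn
  rw [Real.dist_eq] at h1 ⊢
  have h2 := abs_le.1 (hab m)
  have h3 := abs_le.1 (hab n)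
  have h4 := abs_lt.1 h1
  rw [abs_lt]
  constructor <;> linarith [h2.1, h2.2, h3.1, h3.2, h4.1, h4.2]

/-- A sequence of finite measures in a compact set converges weakly as soon as the integrals of
bounded continuous functions do. -/
lemma exists_tendsto_of_isCompact {S : Set (FiniteMeasure ℝ)} (hS : IsCompact S)
    {μ : ℕ → FiniteMeasure ℝ} (hμ : ∀ n, μ n ∈ S)
    (h : ∀ f : BoundedContinuousFunction ℝ ℝ,
      ∃ L : ℝ, Tendsto (fun n => ∫ x, f x ∂(μ n : Measure ℝ)) atTop (𝓝 L)) :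
    ∃ ν ∈ S, Tendsto μ atTop (𝓝 ν) := by
  obtain ⟨ν, hν, hcl⟩ := hS.exists_mapClusterPt (f := atTop) (u := μ)
    (tendsto_principal.2 (Eventually.of_forall hμ))
  refine ⟨ν, hν, FiniteMeasure.tendsto_iff_forall_integral_tendsto.2 fun f => ?_⟩
  obtain ⟨L, hL⟩ := h f
  have hcont : Continuous fun ρ : FiniteMeasure ℝ => ∫ x, f x ∂(ρ : Measure ℝ) :=
    FiniteMeasure.continuous_integral_boundedContinuousFunction f
  have h1 : MapClusterPt (∫ x, f x ∂(ν : Measure ℝ)) atTop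
      (fun n => ∫ x, f x ∂(μ n : Measure ℝ)) := hcl.continuousAt_comp hcont.continuousAt
  have h2 : (𝓝 (∫ x, f x ∂(ν : Measure ℝ)) ⊓ 𝓝 L).NeBot :=
    ClusterPt.mono h1 hL
  rwa [eq_of_nhds_neBot h2]

lemma tendsto_measureReal_ival {ℓ : ℕ} (hℓ : 0 < ℓ) (w : List (Fin ℓ) → ℝ≥0) (ε : List (Fin ℓ))
    {c : ℝ≥0} (hc : Tendsto (fun n => partialMass n (shift ε w)) atTop (𝓝 c)) :
    Tendsto (fun n => (approxNN w n : Measure ℝ) (ival ε)) atTop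
      (𝓝 ((pathProd w ε / (ℓ : ℝ≥0) ^ ε.length * c : ℝ≥0) : ℝ≥0∞)) := by
  rw [← tendsto_add_atTop_iff_nat ε.length]
  simp_rw [add_comm _ ε.length, approxNN_ival hℓ]
  exact ENNReal.tendsto_coe.2 (hc.const_mul _)

/-- The approximations converge weakly as soon as the total masses of all subtrees converge: they
stay in a compact set of measures carried by `[0, 1]`. -/
lemma exists_tendsto_approxNN {ℓ : ℕ} (hℓ : 2 ≤ ℓ) (w : List (Fin ℓ) → ℝ≥0)
    (h : ∀ ε, ∃ c : ℝ≥0, Tendsto (fun n => partialMass n (shift ε w)) atTop (𝓝 c)) :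
    ∃ ν : FiniteMeasure ℝ, Tendsto (approxNN w) atTop (𝓝 ν) ∧
      (ν : Measure ℝ) (Set.Icc 0 1)ᶜ = 0 := by
  have hℓ0 : 0 < ℓ := by omega
  obtain ⟨c, hc⟩ := h []
  obtain ⟨C, hC⟩ := hc.bddAbove_range
  have hC' : ∀ n, partialMass n w ≤ C := fun n => hC ⟨n, rfl⟩
  have hmem : ∀ n, approxNN w n ∈ {μ : FiniteMeasure ℝ | μ.mass ≤ C ∧ μ (Set.Icc 0 1)ᶜ = 0} := by
    intro n
    refine ⟨?_, ?_⟩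
    · rw [← ENNReal.coe_le_coe, FiniteMeasure.ennreal_mass, approxNN_univ hℓ0]
      exact_mod_cast hC' n
    · rw [FiniteMeasure.null_iff_toMeasure_null]
      exact measure_mono_null (Set.compl_subset_compl.2 Set.Ico_subset_Icc_self)
        (approxNN_compl hℓ0 w n)
  obtain ⟨ν, hν, hlim⟩ := exists_tendsto_of_isCompact
    (isCompact_setOfPred_finiteMeasure_le_of_isCompact C isCompact_Icc) hmem
    (exists_tendsto_integral (ℓ := ℓ) hℓ _ (approxNN_compl hℓ0 w) (C := C) (fun n => by
      rw [Measure.real, approxNN_univ hℓ0]; exact_mod_cast hC' n) fun ε => by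
        obtain ⟨c, hc⟩ := h ε
        exact ⟨_, (ENNReal.tendsto_toReal ENNReal.coe_ne_top).comp
          (tendsto_measureReal_ival hℓ0 w ε hc)⟩)
  exact ⟨ν, hlim, (FiniteMeasure.null_iff_toMeasure_null _ _).1 hν.2⟩

lemma cascade_eq_of_tendsto {ℓ : ℕ} {w : List (Fin ℓ) → ℝ} {ν : FiniteMeasure ℝ}
    (h : Tendsto (approx w) atTop (𝓝 ν)) : cascade w = ν := by
  have hex : ∃ μ : FiniteMeasure ℝ, Tendsto (approx w) atTop (𝓝 μ) := ⟨ν, h⟩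
  rw [cascade, dif_pos hex]
  exact tendsto_nhds_unique hex.choose_spec h

/-- The mass of a point is controlled by the masses of its neighbourhoods along a weakly
convergent sequence. -/
lemma measure_singleton_le_liminf {μ : ℕ → FiniteMeasure ℝ} {ν : FiniteMeasure ℝ}
    (h : Tendsto μ atTop (𝓝 ν)) (a : ℝ) {δ : ℝ} (hδ : 0 < δ) :
    (ν : Measure ℝ) {a} ≤ liminf (fun n => (μ n : Measure ℝ) (Metric.ball a δ)) atTop := by
  let g := thickenedIndicator hδ ({a} : Set ℝ)
  have h1 := FiniteMeasure.tendsto_iff_forall_lintegral_tendsto.1 h g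
  have h2 : (ν : Measure ℝ) {a} ≤ ∫⁻ x, g x ∂(ν : Measure ℝ) := by
    rw [← lintegral_indicator_one (measurableSet_singleton a)]
    refine lintegral_mono fun x => ?_
    by_cases hx : x ∈ ({a} : Set ℝ)
    · simp [hx, g, thickenedIndicator_one hδ _ hx]
    · simp [hx]
  refine h2.trans ?_
  rw [← h1.liminf_eq]
  refine liminf_le_liminf (Eventually.of_forall fun n => ?_)
  rw [← lintegral_indicator_one Metric.isOpen_ball.measurableSet]
  refine lintegral_mono fun x => ?_
  by_cases hx : x ∈ Metric.ball a δ
  · simp only [hx, Set.indicator_of_mem, Pi.one_apply]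
    exact_mod_cast thickenedIndicator_le_one hδ _ x
  · have : g x = 0 := thickenedIndicator_zero hδ _ (by rwa [Metric.thickening_singleton])
    simp [this]

/-- If the limit has no atom at `ℓ`-adic points, then the mass of each `ℓ`-adic interval is the
limit of its masses under the approximations. Closed intervals give one inequality, and the total
masses agree. -/
lemma measure_ival_eq {ℓ : ℕ} (hℓ : 0 < ℓ) {w : List (Fin ℓ) → ℝ≥0} {c : List (Fin ℓ) → ℝ≥0}
    (hc : ∀ ε, Tendsto (fun n => partialMass n (shift ε w)) atTop (𝓝 (c ε)))
    {ν : FiniteMeasure ℝ} (hν : Tendsto (approxNN w) atTop (𝓝 ν))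
    (hsupp : (ν : Measure ℝ) (Set.Icc 0 1)ᶜ = 0)
    (hatom : ∀ n : ℕ, ∀ i : ℤ, (ν : Measure ℝ) {(i : ℝ) / (ℓ : ℝ) ^ n} = 0) (ε : List (Fin ℓ)) :
    (ν : Measure ℝ) (ival ε) = ((pathProd w ε / (ℓ : ℝ≥0) ^ ε.length * c ε : ℝ≥0) : ℝ≥0∞) := by
  have hle : ∀ δ : List (Fin ℓ), ((pathProd w δ / (ℓ : ℝ≥0) ^ δ.length * c δ : ℝ≥0) : ℝ≥0∞)
      ≤ (ν : Measure ℝ) (ival δ) := by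
    intro δ
    obtain ⟨a, ha⟩ := exists_ival_eq_cell δ
    rw [cell_eq_Ico hℓ] at ha
    have h1 := FiniteMeasure.limsup_measure_closed_le_of_tendsto hν
      (isClosed_Icc (a := (a : ℝ) / (ℓ : ℝ) ^ δ.length) (b := ((a : ℝ) + 1) / (ℓ : ℝ) ^ δ.length))
    have h2 : (ν : Measure ℝ) (Set.Icc ((a : ℝ) / (ℓ : ℝ) ^ δ.length)
        (((a : ℝ) + 1) / (ℓ : ℝ) ^ δ.length)) ≤ (ν : Measure ℝ) (ival δ) := by
      have h3 : Set.Icc ((a : ℝ) / (ℓ : ℝ) ^ δ.length) (((a : ℝ) + 1) / (ℓ : ℝ) ^ δ.length)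
          ⊆ ival δ ∪ {((a + 1 : ℤ) : ℝ) / (ℓ : ℝ) ^ δ.length} := by
        rw [ha]
        intro x hx
        rcases hx.2.lt_or_eq with h | h
        · exact Or.inl ⟨hx.1, h⟩
        · right; rw [h]; push_cast; rfl
      refine (measure_mono h3).trans ((measure_union_le _ _).trans ?_)
      rw [hatom, add_zero]
    refine le_trans ?_ (h1.trans h2)
    rw [← (tendsto_measureReal_ival hℓ w δ (hc δ)).limsup_eq]
    refine limsup_le_limsup (Eventually.of_forall fun n => measure_mono ?_)
    rw [ha]; exact Set.Ico_subset_Icc_self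
  -- both sides have the same sum over the words of a given length
  have hsum : ∑ δ ∈ words ℓ ε.length,
      ((pathProd w δ / (ℓ : ℝ≥0) ^ δ.length * c δ : ℝ≥0) : ℝ≥0∞)
      = ∑ δ ∈ words ℓ ε.length, (ν : Measure ℝ) (ival δ) := by
    have h1 : Tendsto (fun n => (approxNN w n : Measure ℝ) Set.univ) atTop
        (𝓝 ((ν : Measure ℝ) Set.univ)) := by
      have := (FiniteMeasure.continuous_mass.tendsto ν).comp hν
      simp_rw [← FiniteMeasure.ennreal_mass]
      exact ENNReal.tendsto_coe.2 this
    have h2 : ∀ n, (approxNN w n : Measure ℝ) Set.univ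
        = ∑ δ ∈ words ℓ ε.length, (approxNN w n : Measure ℝ) (ival δ) := by
      intro n
      rw [sum_measure_ival hℓ, ← measure_add_measure_compl
        (measurableSet_Ico (a := (0 : ℝ)) (b := 1)), approxNN_compl hℓ, add_zero]
    simp_rw [h2] at h1
    have h3 := tendsto_nhds_unique h1
      (tendsto_finsetSum _ fun δ _ => tendsto_measureReal_ival hℓ w δ (hc δ))
    rw [← h3, sum_measure_ival hℓ]
    have h4 : (ν : Measure ℝ) (Set.Ico 0 1)ᶜ = 0 := by
      refine measure_mono_null ?_ (measure_union_null hsupp (hatom 0 1))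
      intro x hx
      by_cases h : x ∈ Set.Icc (0 : ℝ) 1
      · right
        simp only [pow_zero, div_one, Int.cast_one, Set.mem_singleton_iff]
        by_contra hne
        exact hx ⟨h.1, lt_of_le_of_ne h.2 hne⟩
      · exact Or.inl h
    rw [← measure_add_measure_compl (measurableSet_Ico (a := (0 : ℝ)) (b := 1)), h4, add_zero]
  by_contra hne
  have hlt := lt_of_le_of_ne (hle ε) (Ne.symm hne)
  rw [← Finset.add_sum_erase _ _ (mem_words.2 (rfl : ε.length = ε.length)),
    ← Finset.add_sum_erase _ _ (mem_words.2 (rfl : ε.length = ε.length))] at hsum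
  exact (ENNReal.add_lt_add_of_lt_of_le (ENNReal.sum_ne_top.2 fun _ _ => ENNReal.coe_ne_top) hlt
    (Finset.sum_le_sum fun δ _ => hle δ)).ne hsum

/-! ### The product law and the martingale of total masses -/

/-- The law of the family of weights: independent weights with law `ν`, one for each word. The
weight of the empty word is never used by the cascade; it is kept so that `shift` preserves the
law. -/
noncomputable abbrev weightLaw (ℓ : ℕ) (ν : Measure ℝ≥0) : Measure (List (Fin ℓ) → ℝ≥0) :=
  Measure.infinitePi (fun _ : List (Fin ℓ) => ν)

/-- The σ-algebra generated by the weights of the words in `S`. -/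
@[reducible] def sigmaWords {ℓ : ℕ} (S : Set (List (Fin ℓ))) :
    MeasurableSpace (List (Fin ℓ) → ℝ≥0) :=
  ⨆ ζ ∈ S, MeasurableSpace.comap (fun w => w ζ) inferInstance

lemma sigmaWords_le {ℓ : ℕ} (S : Set (List (Fin ℓ))) : sigmaWords S ≤ MeasurableSpace.pi :=
  iSup₂_le fun ζ _ => (measurable_pi_apply ζ).comap_le

lemma sigmaWords_mono {ℓ : ℕ} {S T : Set (List (Fin ℓ))} (h : S ⊆ T) :
    sigmaWords S ≤ sigmaWords T :=
  iSup₂_le fun ζ hζ => le_iSup₂_of_le ζ (h hζ) le_rfl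

lemma measurable_eval_sigmaWords {ℓ : ℕ} {S : Set (List (Fin ℓ))} {ζ : List (Fin ℓ)} (h : ζ ∈ S) :
    Measurable[sigmaWords S] (fun w : List (Fin ℓ) → ℝ≥0 => w ζ) :=
  Measurable.mono (comap_measurable _) (le_iSup₂_of_le ζ h le_rfl) le_rfl

lemma measurable_shift_sigmaWords {ℓ : ℕ} (ε : List (Fin ℓ)) {S T : Set (List (Fin ℓ))}
    (h : ∀ ζ ∈ T, ε ++ ζ ∈ S) :
    Measurable[sigmaWords S, sigmaWords T] (shift ε : (List (Fin ℓ) → ℝ≥0) → _) := by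
  rw [measurable_iff_comap_le, sigmaWords, MeasurableSpace.comap_iSup]
  refine iSup_le fun ζ => ?_
  rw [MeasurableSpace.comap_iSup]
  refine iSup_le fun hζ => ?_
  rw [MeasurableSpace.comap_comp]
  exact (measurable_eval_sigmaWords (h ζ hζ)).comap_le

lemma measurable_shift {ℓ : ℕ} (ε : List (Fin ℓ)) :
    Measurable (shift ε : (List (Fin ℓ) → ℝ≥0) → _) :=
  measurable_pi_lambda _ fun _ => measurable_pi_apply _

lemma measurable_pathProd_sigmaWords {ℓ : ℕ} {S : Set (List (Fin ℓ))} {ε : List (Fin ℓ)}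
    (h : ∀ k < ε.length, ε.take (k + 1) ∈ S) :
    Measurable[sigmaWords S] (fun w : List (Fin ℓ) → ℝ≥0 => pathProd w ε) :=
  Finset.measurable_fun_prod _ fun k hk => measurable_eval_sigmaWords (h k (Finset.mem_range.1 hk))

lemma measurable_partialMass_sigmaWords {ℓ : ℕ} {S : Set (List (Fin ℓ))} {n : ℕ}
    (h : ∀ ζ : List (Fin ℓ), ζ ≠ [] → ζ.length ≤ n → ζ ∈ S) :
    Measurable[sigmaWords S] (fun w : List (Fin ℓ) → ℝ≥0 => partialMass n w) := by
  refine Finset.measurable_fun_sum _ fun ε hε => Measurable.div_const ?_ _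
  refine measurable_pathProd_sigmaWords fun k hk => h _ ?_ ?_
  · rw [← List.length_pos_iff, List.length_take]; omega
  · rw [List.length_take, ← mem_words.1 hε]; omega

lemma measurable_pathProd {ℓ : ℕ} (ε : List (Fin ℓ)) :
    Measurable (fun w : List (Fin ℓ) → ℝ≥0 => pathProd w ε) :=
  (measurable_pathProd_sigmaWords (S := Set.univ) fun _ _ => trivial).mono (sigmaWords_le _) le_rfl

lemma measurable_partialMass {ℓ : ℕ} (n : ℕ) :
    Measurable (fun w : List (Fin ℓ) → ℝ≥0 => partialMass n w) :=
  (measurable_partialMass_sigmaWords (S := Set.univ) fun _ _ _ => trivial).mono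
    (sigmaWords_le _) le_rfl

/-- The limit `Y` of the total masses `partialMass n w`. The lower limit makes sense for all
weights. -/
noncomputable def totalMass {ℓ : ℕ} (w : List (Fin ℓ) → ℝ≥0) : ℝ≥0 :=
  (liminf (fun n => (partialMass n w : ℝ≥0∞)) atTop).toNNReal

lemma totalMass_eq_of_tendsto {ℓ : ℕ} {w : List (Fin ℓ) → ℝ≥0} {c : ℝ≥0}
    (h : Tendsto (fun n => partialMass n w) atTop (𝓝 c)) : totalMass w = c := by
  rw [totalMass, (ENNReal.tendsto_coe.2 h).liminf_eq, ENNReal.toNNReal_coe]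

lemma measurable_toNNReal_liminf {α : Type*} {mα : MeasurableSpace α} {f : ℕ → α → ℝ≥0}
    (hf : ∀ n, Measurable (f n)) :
    Measurable fun a => (liminf (fun n => (f n a : ℝ≥0∞)) atTop).toNNReal :=
  (Measurable.liminf fun n => (hf n).coe_nnreal_ennreal).ennreal_toNNReal

lemma measurable_totalMass_sigmaWords {ℓ : ℕ} :
    Measurable[sigmaWords {ζ : List (Fin ℓ) | ζ ≠ []}] (totalMass (ℓ := ℓ)) :=
  measurable_toNNReal_liminf fun _ => measurable_partialMass_sigmaWords fun _ h _ => h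

lemma measurable_totalMass {ℓ : ℕ} : Measurable (totalMass (ℓ := ℓ)) :=
  measurable_totalMass_sigmaWords.mono (sigmaWords_le _) le_rfl

section Law

variable {ℓ : ℕ} (ν : Measure ℝ≥0) [IsProbabilityMeasure ν]

lemma measurePreserving_shift (ε : List (Fin ℓ)) :
    MeasurePreserving (shift ε) (weightLaw ℓ ν) (weightLaw ℓ ν) :=
  ⟨measurable_shift ε, Measure.map_infinitePi_infinitePi_of_inj (P := fun _ => ν)
    (f := fun η => ε ++ η) (List.append_right_injective ε)⟩

lemma iIndepFun_eval : iIndepFun (fun ζ (w : List (Fin ℓ) → ℝ≥0) => w ζ) (weightLaw ℓ ν) :=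
  iIndepFun_infinitePi (X := fun _ x => x) fun _ => measurable_id

lemma indep_sigmaWords {S T : Set (List (Fin ℓ))} (h : Disjoint S T) :
    Indep (sigmaWords S) (sigmaWords T) (weightLaw ℓ ν) :=
  indep_iSup_of_disjoint (fun ζ => (measurable_pi_apply ζ).comap_le) (iIndepFun_eval ν) h

lemma indepFun_of_sigmaWords {S T : Set (List (Fin ℓ))} (h : Disjoint S T) {α β : Type*}
    [MeasurableSpace α] [MeasurableSpace β] {f : (List (Fin ℓ) → ℝ≥0) → α}
    {g : (List (Fin ℓ) → ℝ≥0) → β} (hf : Measurable[sigmaWords S] f)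
    (hg : Measurable[sigmaWords T] g) : IndepFun f g (weightLaw ℓ ν) :=
  indep_of_indep_of_le_left (indep_of_indep_of_le_right (indep_sigmaWords ν h) hg.comap_le)
    hf.comap_le

lemma take_succ_injective (ε : List (Fin ℓ)) :
    Function.Injective fun k : Fin ε.length => ε.take ((k : ℕ) + 1) := by
  intro i j h
  have := congrArg List.length h
  simp only [List.length_take] at this
  exact Fin.ext (by omega)

lemma pathProd_eq_prod_fin (w : List (Fin ℓ) → ℝ≥0) (ε : List (Fin ℓ)) :
    pathProd w ε = ∏ k : Fin ε.length, w (ε.take ((k : ℕ) + 1)) := by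
  rw [pathProd, Finset.prod_range]

lemma map_prefixes (ε : List (Fin ℓ)) :
    (weightLaw ℓ ν).map (fun w (k : Fin ε.length) => w (ε.take ((k : ℕ) + 1))) =
      Measure.pi fun _ => ν := by
  rw [Measure.map_infinitePi_infinitePi_of_inj (P := fun _ => ν) (take_succ_injective ε),
    Measure.infinitePi_eq_pi]

variable {ν}

lemma lintegral_pathProd (hν : ∫⁻ x, (x : ℝ≥0∞) ∂ν = 1) (ε : List (Fin ℓ)) :
    ∫⁻ w, (pathProd w ε : ℝ≥0∞) ∂(weightLaw ℓ ν) = 1 := by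
  simp_rw [pathProd_eq_prod_fin, ENNReal.ofNNReal_finsetProd]
  rw [lintegral_prod_eq_prod_lintegral_of_indepFun]
  · refine Finset.prod_eq_one fun k _ => ?_
    rw [← hν]
    exact (measurePreserving_eval_infinitePi (fun _ => ν) _).lintegral_comp
      measurable_coe_nnreal_ennreal
  · have h := (iIndepFun_eval (ℓ := ℓ) ν).precomp (take_succ_injective ε)
    exact h.comp (fun _ x => (x : ℝ≥0∞)) fun _ => measurable_coe_nnreal_ennreal
  · exact fun k => (measurable_pi_apply (ε.take ((k : ℕ) + 1))).coe_nnreal_ennreal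

lemma lintegral_partialMass (hℓ : 0 < ℓ) (hν : ∫⁻ x, (x : ℝ≥0∞) ∂ν = 1) (n : ℕ) :
    ∫⁻ w, (partialMass n w : ℝ≥0∞) ∂(weightLaw ℓ ν) = 1 := by
  have hℓ0 : (ℓ : ℝ≥0) ≠ 0 := by exact_mod_cast hℓ.ne'
  have h1 : ∀ w : List (Fin ℓ) → ℝ≥0, (partialMass n w : ℝ≥0∞)
      = ∑ ε ∈ words ℓ n, (pathProd w ε : ℝ≥0∞) * ((ℓ : ℝ≥0∞) ^ n)⁻¹ := by
    intro w
    rw [partialMass, ENNReal.ofNNReal_finsetSum]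
    refine Finset.sum_congr rfl fun ε _ => ?_
    rw [ENNReal.coe_div (pow_ne_zero _ hℓ0), div_eq_mul_inv]
    simp
  simp_rw [h1]
  rw [lintegral_finsetSum _ fun ε _ => (measurable_pathProd ε).coe_nnreal_ennreal.mul_const _]
  simp_rw [lintegral_mul_const _ (measurable_pathProd _).coe_nnreal_ennreal,
    lintegral_pathProd hν, Finset.sum_const, card_words, one_mul, nsmul_eq_mul]
  push_cast
  exact ENNReal.mul_inv_cancel (by positivity) (by finiteness)

lemma integrable_coe_of_lintegral {α : Type*} {mα : MeasurableSpace α} {μ : Measure α}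
    {f : α → ℝ≥0} (hf : Measurable f) (h : ∫⁻ a, (f a : ℝ≥0∞) ∂μ ≠ ∞) :
    Integrable (fun a => (f a : ℝ)) μ := by
  refine ⟨hf.coe_nnreal_real.aestronglyMeasurable, ?_⟩
  rw [HasFiniteIntegral]
  simpa using h.lt_top

lemma integral_coe_eq_toReal_lintegral {α : Type*} {mα : MeasurableSpace α} {μ : Measure α}
    {f : α → ℝ≥0} (hf : Measurable f) :
    ∫ a, (f a : ℝ) ∂μ = (∫⁻ a, (f a : ℝ≥0∞) ∂μ).toReal := by
  rw [integral_eq_lintegral_of_nonneg_ae (f := fun a => (f a : ℝ))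
    (Eventually.of_forall fun a => (f a).2) hf.coe_nnreal_real.aestronglyMeasurable]
  simp

/-- The filtration whose `n`-th σ-algebra is generated by the weights of the words of length at most
`n`. -/
def generations (ℓ : ℕ) :
    Filtration ℕ (MeasurableSpace.pi : MeasurableSpace (List (Fin ℓ) → ℝ≥0)) where
  seq n := sigmaWords {ζ | ζ.length ≤ n}
  mono' _ _ h := sigmaWords_mono fun _ hζ => le_trans hζ h
  le' _ := sigmaWords_le _

/-- Conditionally on the first `n` generations, a functional of the subtrees issued from generation
`n` is replaced by its mean. -/
lemma condExp_sum_shift (hν : ∫⁻ x, (x : ℝ≥0∞) ∂ν = 1) (n : ℕ)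
    {Z : (List (Fin ℓ) → ℝ≥0) → ℝ} (hZ : Measurable[sigmaWords {ζ | ζ ≠ []}] Z)
    (hZi : Integrable Z (weightLaw ℓ ν)) :
    (weightLaw ℓ ν)[fun w => ∑ ε ∈ words ℓ n,
        ((pathProd w ε / (ℓ : ℝ≥0) ^ n : ℝ≥0) : ℝ) * Z (shift ε w) | generations ℓ n]
      =ᵐ[weightLaw ℓ ν] fun w => (∫ w, Z w ∂(weightLaw ℓ ν)) * (partialMass n w : ℝ) := by
  have hZm : Measurable Z := hZ.mono (sigmaWords_le _) le_rfl
  have hZs : ∀ ε ∈ words ℓ n, Measurable[sigmaWords {ζ | n < ζ.length}] fun w => Z (shift ε w) := by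
    intro ε hε
    refine hZ.comp (measurable_shift_sigmaWords ε fun ζ hζ => ?_)
    have h1 := mem_words.1 hε
    have h2 := List.length_pos_iff.2 hζ
    simp only [Set.mem_ofPred_eq, List.length_append]; omega
  have hdisj : Disjoint {ζ : List (Fin ℓ) | n < ζ.length} {ζ | ζ.length ≤ n} :=
    Set.disjoint_left.2 fun ζ h1 h2 => not_lt.2 (show ζ.length ≤ n from h2) h1
  have hZsi : ∀ ε, Integrable (fun w => Z (shift ε w)) (weightLaw ℓ ν) := fun ε =>
    (measurePreserving_shift ν ε).integrable_comp_of_integrable hZi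
  have hpm : ∀ ε ∈ words ℓ n, Measurable[sigmaWords {ζ : List (Fin ℓ) | ζ.length ≤ n}]
      fun w : List (Fin ℓ) → ℝ≥0 => ((pathProd w ε / (ℓ : ℝ≥0) ^ n : ℝ≥0) : ℝ) := by
    intro ε hε
    refine Measurable.coe_nnreal_real (Measurable.div_const ?_ _)
    refine measurable_pathProd_sigmaWords fun k hk => ?_
    have := mem_words.1 hε
    simp only [Set.mem_ofPred_eq, List.length_take]; omega
  have hpi : ∀ ε : List (Fin ℓ), Integrable
      (fun w => ((pathProd w ε / (ℓ : ℝ≥0) ^ n : ℝ≥0) : ℝ)) (weightLaw ℓ ν) := by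
    intro ε
    simp_rw [NNReal.coe_div]
    exact (integrable_coe_of_lintegral (measurable_pathProd ε)
      (by rw [lintegral_pathProd hν]; simp)).div_const _
  have hprod : ∀ ε ∈ words ℓ n, Integrable (fun w => ((pathProd w ε / (ℓ : ℝ≥0) ^ n : ℝ≥0) : ℝ) *
      Z (shift ε w)) (weightLaw ℓ ν) := fun ε hε =>
    (indepFun_of_sigmaWords ν hdisj.symm (hpm ε hε) (hZs ε hε)).integrable_mul (hpi ε) (hZsi ε)
  have hsum : (fun w : List (Fin ℓ) → ℝ≥0 => ∑ ε ∈ words ℓ n,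
      ((pathProd w ε / (ℓ : ℝ≥0) ^ n : ℝ≥0) : ℝ) * Z (shift ε w))
      = ∑ ε ∈ words ℓ n, fun w => ((pathProd w ε / (ℓ : ℝ≥0) ^ n : ℝ≥0) : ℝ) * Z (shift ε w) := by
    ext w; simp
  rw [hsum]
  refine (condExp_finsetSum hprod _).trans ?_
  have hterm : ∀ ε ∈ words ℓ n, (weightLaw ℓ ν)[fun w =>
      ((pathProd w ε / (ℓ : ℝ≥0) ^ n : ℝ≥0) : ℝ) * Z (shift ε w) | generations ℓ n]
      =ᵐ[weightLaw ℓ ν] fun w => ((pathProd w ε / (ℓ : ℝ≥0) ^ n : ℝ≥0) : ℝ) *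
        ∫ w, Z w ∂(weightLaw ℓ ν) := by
    intro ε hε
    have h1 := condExp_mul_of_stronglyMeasurable_left (μ := weightLaw ℓ ν)
      (m := generations ℓ n) (hpm ε hε).stronglyMeasurable (hprod ε hε) (hZsi ε)
    have h2 := condExp_indep_eq (μ := weightLaw ℓ ν) (sigmaWords_le _)
      ((generations ℓ).le n) (hZs ε hε).stronglyMeasurable (indep_sigmaWords ν hdisj)
    have h3 : ∫ w, Z (shift ε w) ∂(weightLaw ℓ ν) = ∫ w, Z w ∂(weightLaw ℓ ν) := by
      conv_rhs => rw [← (measurePreserving_shift ν ε).map_eq]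
      rw [integral_map (measurable_shift ε).aemeasurable hZm.aestronglyMeasurable]
    filter_upwards [h1, h2] with w hw1 hw2
    refine hw1.trans ?_
    rw [Pi.mul_apply, hw2, h3]
  filter_upwards [(Finset.eventually_all _).2 hterm] with w hw
  rw [Finset.sum_apply, Finset.sum_congr rfl hw, ← Finset.sum_mul, mul_comm, partialMass]
  push_cast
  rfl

lemma integrable_partialMass (hℓ : 0 < ℓ) (hν : ∫⁻ x, (x : ℝ≥0∞) ∂ν = 1) (n : ℕ) :
    Integrable (fun w : List (Fin ℓ) → ℝ≥0 => (partialMass n w : ℝ)) (weightLaw ℓ ν) :=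
  integrable_coe_of_lintegral (measurable_partialMass n)
    (by rw [lintegral_partialMass hℓ hν]; simp)

lemma integral_partialMass (hℓ : 0 < ℓ) (hν : ∫⁻ x, (x : ℝ≥0∞) ∂ν = 1) (n : ℕ) :
    ∫ w, (partialMass n w : ℝ) ∂(weightLaw ℓ ν) = 1 := by
  rw [integral_coe_eq_toReal_lintegral (measurable_partialMass n), lintegral_partialMass hℓ hν]
  simp

lemma martingale_partialMass (hℓ : 0 < ℓ) (hν : ∫⁻ x, (x : ℝ≥0∞) ∂ν = 1) :
    Martingale (fun n (w : List (Fin ℓ) → ℝ≥0) => (partialMass n w : ℝ)) (generations ℓ)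
      (weightLaw ℓ ν) := by
  refine martingale_nat (fun n => ?_) (integrable_partialMass hℓ hν) fun n => ?_
  · exact (measurable_partialMass_sigmaWords fun _ _ h => h).coe_nnreal_real.stronglyMeasurable
  · have h := condExp_sum_shift hν n (Z := fun w => (partialMass 1 w : ℝ))
      (measurable_partialMass_sigmaWords fun _ h _ => h).coe_nnreal_real
      (integrable_partialMass hℓ hν 1)
    rw [integral_partialMass hℓ hν] at h
    simp_rw [one_mul] at h
    refine h.symm.trans (Eq.eventuallyEq ?_)
    congr 1
    ext w
    rw [partialMass_add]
    push_cast
    rfl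

/-- The total masses converge almost surely, as a non-negative martingale. -/
lemma ae_tendsto_partialMass (hℓ : 0 < ℓ) (hν : ∫⁻ x, (x : ℝ≥0∞) ∂ν = 1) :
    ∀ᵐ w ∂(weightLaw ℓ ν), Tendsto (fun n => partialMass n w) atTop (𝓝 (totalMass w)) := by
  have h := (martingale_partialMass hℓ hν).submartingale.exists_ae_tendsto_of_bdd (R := 1)
    fun n => ?_
  · filter_upwards [h] with w ⟨c, hc⟩
    have hc0 : 0 ≤ c := ge_of_tendsto' hc fun n => (partialMass n w).2
    lift c to ℝ≥0 using hc0
    have h1 := NNReal.tendsto_coe.1 hc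
    rwa [totalMass_eq_of_tendsto h1]
  · rw [eLpNorm_one_eq_lintegral_enorm]
    have : ∀ w : List (Fin ℓ) → ℝ≥0, ‖(partialMass n w : ℝ)‖ₑ = (partialMass n w : ℝ≥0∞) := by
      intro w; simp
    simp_rw [this, lintegral_partialMass hℓ hν]
    simp

lemma ae_tendsto_partialMass_shift (hℓ : 0 < ℓ) (hν : ∫⁻ x, (x : ℝ≥0∞) ∂ν = 1) :
    ∀ᵐ w ∂(weightLaw ℓ ν), ∀ ε, Tendsto (fun n => partialMass n (shift ε w)) atTop
      (𝓝 (totalMass (shift ε w))) :=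
  ae_all_iff.2 fun ε => (measurePreserving_shift ν ε).quasiMeasurePreserving.ae
    (ae_tendsto_partialMass hℓ hν)

/-- The self-similarity of the limit mass. -/
lemma totalMass_eq_sum {w : List (Fin ℓ) → ℝ≥0}
    (h : ∀ ε, Tendsto (fun n => partialMass n (shift ε w)) atTop (𝓝 (totalMass (shift ε w))))
    (n : ℕ) :
    totalMass w = ∑ ε ∈ words ℓ n, pathProd w ε / (ℓ : ℝ≥0) ^ n * totalMass (shift ε w) := by
  have h1 : Tendsto (fun p => partialMass (n + p) w) atTop
      (𝓝 (∑ ε ∈ words ℓ n, pathProd w ε / (ℓ : ℝ≥0) ^ n * totalMass (shift ε w))) := by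
    simp_rw [partialMass_add]
    exact tendsto_finsetSum _ fun ε _ => (h ε).const_mul _
  simp_rw [add_comm n] at h1
  exact totalMass_eq_of_tendsto ((tendsto_add_atTop_iff_nat n).1 h1)

lemma lintegral_totalMass_le (hℓ : 0 < ℓ) (hν : ∫⁻ x, (x : ℝ≥0∞) ∂ν = 1) :
    ∫⁻ w, (totalMass w : ℝ≥0∞) ∂(weightLaw ℓ ν) ≤ 1 := by
  calc ∫⁻ w, (totalMass w : ℝ≥0∞) ∂(weightLaw ℓ ν)
      ≤ ∫⁻ w, liminf (fun n => (partialMass n w : ℝ≥0∞)) atTop ∂(weightLaw ℓ ν) :=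
        lintegral_mono fun w => ENNReal.coe_toNNReal_le_self
    _ ≤ liminf (fun n => ∫⁻ w, (partialMass n w : ℝ≥0∞) ∂(weightLaw ℓ ν)) atTop :=
        lintegral_liminf_le fun n => (measurable_partialMass n).coe_nnreal_ennreal
    _ = 1 := by simp_rw [lintegral_partialMass hℓ hν]; simp

lemma integrable_totalMass (hℓ : 0 < ℓ) (hν : ∫⁻ x, (x : ℝ≥0∞) ∂ν = 1) :
    Integrable (fun w : List (Fin ℓ) → ℝ≥0 => (totalMass w : ℝ)) (weightLaw ℓ ν) :=
  integrable_coe_of_lintegral measurable_totalMass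
    (ne_top_of_le_ne_top (by simp) (lintegral_totalMass_le hℓ hν))

/-- If the limit mass `Y` is not almost surely zero then `E[Y] = 1`: by self-similarity
`E[Y | ℱₙ] = E[Y] Yₙ`, and the two sides converge to `Y` and `E[Y] Y`. -/
lemma integral_totalMass_eq_one (hℓ : 0 < ℓ) (hν : ∫⁻ x, (x : ℝ≥0∞) ∂ν = 1)
    (hne : ¬ ∀ᵐ w ∂(weightLaw ℓ ν), totalMass w = 0) :
    ∫ w, (totalMass w : ℝ) ∂(weightLaw ℓ ν) = 1 := by
  set P := weightLaw ℓ ν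
  have hlim := ae_tendsto_partialMass (ℓ := ℓ) hℓ hν
  have hcond : ∀ n, P[fun w => (totalMass w : ℝ) | generations ℓ n] =ᵐ[P]
      fun w => (∫ w, (totalMass w : ℝ) ∂P) * (partialMass n w : ℝ) := by
    intro n
    refine EventuallyEq.trans (condExp_congr_ae ?_) (condExp_sum_shift hν n
      (Z := fun w => (totalMass w : ℝ)) measurable_totalMass_sigmaWords.coe_nnreal_real
      (integrable_totalMass hℓ hν))
    filter_upwards [ae_tendsto_partialMass_shift hℓ hν] with w hw
    have := totalMass_eq_sum hw n
    conv_lhs => rw [this]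
    push_cast
    rfl
  have hmeas : Measurable[⨆ n, generations ℓ n] fun w : List (Fin ℓ) → ℝ≥0 => (totalMass w : ℝ) :=
    Measurable.coe_nnreal_real (measurable_toNNReal_liminf fun n =>
      (measurable_partialMass_sigmaWords (S := {ζ : List (Fin ℓ) | ζ.length ≤ n})
        fun _ _ h => h).mono (le_iSup (fun n => generations ℓ n) n) le_rfl)
  have hup := tendsto_ae_condExp (μ := P) (ℱ := generations ℓ) fun w => (totalMass w : ℝ)
  rw [condExp_of_stronglyMeasurable (iSup_le fun n => (generations ℓ).le n)
    hmeas.stronglyMeasurable (integrable_totalMass hℓ hν)] at hup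
  by_contra hc
  refine hne ?_
  filter_upwards [hlim, hup, ae_all_iff.2 hcond] with w h1 h2 h3
  simp_rw [h3] at h2
  have h4 := tendsto_nhds_unique h2 ((NNReal.tendsto_coe.2 h1).const_mul _)
  have h5 : (1 - ∫ w, (totalMass w : ℝ) ∂P) * (totalMass w : ℝ) = 0 := by linarith
  rcases mul_eq_zero.1 h5 with h | h
  · exact absurd (by linarith) hc
  · exact_mod_cast h

end Law

/-! ### The masses of adic intervals under the cascade measure -/

section Law

variable {ℓ : ℕ} {ν : Measure ℝ≥0} [IsProbabilityMeasure ν]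

lemma measurable_approxNN (hℓ : 0 < ℓ) (n : ℕ) {B : Set ℝ} (hB : MeasurableSet B) :
    Measurable fun w : List (Fin ℓ) → ℝ≥0 => (approxNN w n : Measure ℝ) B := by
  simp_rw [approxNN_apply hℓ _ n hB]
  exact Finset.measurable_fun_sum _ fun ε _ =>
    (measurable_pathProd ε).coe_nnreal_ennreal.mul_const _

lemma lintegral_approxNN_le (hℓ : 0 < ℓ) (hν : ∫⁻ x, (x : ℝ≥0∞) ∂ν = 1) (n : ℕ) {B : Set ℝ}
    (hB : MeasurableSet B) :
    ∫⁻ w : List (Fin ℓ) → ℝ≥0, (approxNN w n : Measure ℝ) B ∂(weightLaw ℓ ν) ≤ volume B := by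
  simp_rw [approxNN_apply hℓ _ n hB]
  rw [lintegral_finsetSum _ fun ε _ => (measurable_pathProd ε).coe_nnreal_ennreal.mul_const _]
  simp_rw [lintegral_mul_const _ (measurable_pathProd _).coe_nnreal_ennreal, lintegral_pathProd hν,
    one_mul]
  rw [sum_measure_ival_inter hℓ _ n hB]
  exact measure_mono Set.inter_subset_right

lemma ae_iInf_eq_zero_of_lintegral_le {α : Type*} {mα : MeasurableSpace α} {μ : Measure α}
    {f : ℕ → α → ℝ≥0∞} (hf : ∀ n, Measurable (f n)) {e : ℕ → ℝ≥0∞} (he : Tendsto e atTop (𝓝 0))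
    (h : ∀ n, ∫⁻ a, f n a ∂μ ≤ e n) : ∀ᵐ a ∂μ, ⨅ n, f n a = 0 := by
  have h0 : ∫⁻ a, ⨅ n, f n a ∂μ = 0 := by
    refine le_antisymm (ge_of_tendsto' he fun n => ?_) bot_le
    exact (lintegral_mono fun a => iInf_le _ n).trans (h n)
  exact (lintegral_eq_zero_iff (Measurable.iInf hf)).1 h0

/-- Almost surely a weak limit has no atom at a given point, since the mean of the random
measures `approxNN w n` is Lebesgue measure. -/
lemma ae_measure_singleton_eq_zero (hℓ : 0 < ℓ) (hν : ∫⁻ x, (x : ℝ≥0∞) ∂ν = 1) (a : ℝ) :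
    ∀ᵐ w : List (Fin ℓ) → ℝ≥0 ∂(weightLaw ℓ ν), ∀ μ : FiniteMeasure ℝ,
      Tendsto (approxNN w) atTop (𝓝 μ) → (μ : Measure ℝ) {a} = 0 := by
  have hlim : Tendsto (fun k : ℕ => ENNReal.ofReal (2 * (1 / ((k : ℝ) + 1)))) atTop (𝓝 0) := by
    have := ENNReal.tendsto_ofReal (tendsto_one_div_add_atTop_nhds_zero_nat (𝕜 := ℝ).const_mul 2)
    simpa using this
  have h := ae_iInf_eq_zero_of_lintegral_le (μ := weightLaw ℓ ν)
    (f := fun k w => liminf (fun n => (approxNN w n : Measure ℝ)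
      (Metric.ball a (1 / ((k : ℝ) + 1)))) atTop)
    (fun k => Measurable.liminf fun n => measurable_approxNN hℓ n Metric.isOpen_ball.measurableSet)
    hlim fun k => ?_
  · filter_upwards [h] with w hw μ hμ
    refine le_antisymm ?_ bot_le
    rw [← hw]
    exact le_iInf fun k => measure_singleton_le_liminf hμ a (by positivity)
  · refine (lintegral_liminf_le fun n =>
      measurable_approxNN hℓ n Metric.isOpen_ball.measurableSet).trans ?_
    refine (liminf_le_liminf (Eventually.of_forall fun n =>
      lintegral_approxNN_le hℓ hν n Metric.isOpen_ball.measurableSet)).trans ?_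
    rw [liminf_const, Real.volume_ball]

/-- The cascade measure with non-negative weights `w`. -/
noncomputable abbrev cascadeNN (w : List (Fin ℓ) → ℝ≥0) : FiniteMeasure ℝ :=
  cascade fun ε => (w ε : ℝ)

/-- Almost surely the cascade measure is a weak limit, and the masses of the `ℓ`-adic intervals
are the products of the weights with the masses of the subtrees. -/
lemma ae_cascadeNN (hℓ : 2 ≤ ℓ) (hν : ∫⁻ x, (x : ℝ≥0∞) ∂ν = 1) :
    ∀ᵐ w : List (Fin ℓ) → ℝ≥0 ∂(weightLaw ℓ ν),
      Tendsto (approxNN w) atTop (𝓝 (cascadeNN w)) ∧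
      (cascadeNN w : Measure ℝ) (Set.Ico 0 1)ᶜ = 0 ∧
      ∀ ε, (cascadeNN w : Measure ℝ) (ival ε) =
        ((pathProd w ε / (ℓ : ℝ≥0) ^ ε.length * totalMass (shift ε w) : ℝ≥0) : ℝ≥0∞) := by
  have hℓ0 : 0 < ℓ := by omega
  have h1 : ∀ᵐ w : List (Fin ℓ) → ℝ≥0 ∂(weightLaw ℓ ν), ∀ (n : ℕ) (i : ℤ), ∀ μ : FiniteMeasure ℝ,
      Tendsto (approxNN w) atTop (𝓝 μ) → (μ : Measure ℝ) {(i : ℝ) / (ℓ : ℝ) ^ n} = 0 :=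
    ae_all_iff.2 fun n => ae_all_iff.2 fun i => ae_measure_singleton_eq_zero hℓ0 hν _
  filter_upwards [h1, ae_tendsto_partialMass_shift hℓ0 hν] with w hw1 hw2
  obtain ⟨μ, hμ, hsupp⟩ := exists_tendsto_approxNN hℓ w fun ε => ⟨_, hw2 ε⟩
  rw [cascadeNN, cascade_eq_of_tendsto hμ]
  refine ⟨hμ, ?_, measure_ival_eq hℓ0 hw2 hμ hsupp fun n i => hw1 n i μ hμ⟩
  refine measure_mono_null ?_ (measure_union_null hsupp (hw1 0 1 μ hμ))
  intro x hx
  by_cases h : x ∈ Set.Icc (0 : ℝ) 1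
  · right
    simp only [pow_zero, div_one, Int.cast_one, Set.mem_singleton_iff]
    by_contra hne
    exact hx ⟨h.1, lt_of_le_of_ne h.2 hne⟩
  · exact Or.inl h

end Law

/-! ### The entropy of the weights -/

lemma mul_log_ge_neg_one {x : ℝ} (hx : 0 ≤ x) : -1 ≤ x * Real.log x := by
  rcases hx.eq_or_lt with rfl | hx
  · simp
  · have h := mul_le_mul_of_nonneg_left (Real.one_sub_inv_le_log_of_pos hx) hx.le
    rw [mul_sub, mul_inv_cancel₀ hx.ne'] at h
    linarith

lemma abs_mul_log_le {x y : ℝ} (hx : 0 ≤ x) (hxy : x ≤ y) :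
    |x * Real.log x| ≤ 1 + |y * Real.log y| := by
  rw [abs_le]
  refine ⟨by linarith [mul_log_ge_neg_one hx, abs_nonneg (y * Real.log y)], ?_⟩
  rcases le_or_gt x 1 with h | h
  · linarith [mul_nonpos_of_nonneg_of_nonpos hx (Real.log_nonpos hx h),
      abs_nonneg (y * Real.log y)]
  · have : x * Real.log x ≤ y * Real.log y :=
      mul_le_mul hxy (Real.log_le_log (by linarith) hxy) (Real.log_nonneg h.le) (by linarith)
    linarith [le_abs_self (y * Real.log y)]

/-- The function `x ↦ x log x` is superadditive. -/
lemma sum_mul_log_le {ι : Type*} (s : Finset ι) (a : ι → ℝ) (ha : ∀ i ∈ s, 0 ≤ a i) :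
    ∑ i ∈ s, a i * Real.log (a i) ≤ (∑ i ∈ s, a i) * Real.log (∑ i ∈ s, a i) := by
  rw [Finset.sum_mul]
  refine Finset.sum_le_sum fun i hi => ?_
  rcases (ha i hi).eq_or_lt with h | h
  · simp [← h]
  · exact mul_le_mul_of_nonneg_left (Real.log_le_log h (Finset.single_le_sum ha hi)) h.le

lemma mul_log_mul_div {u y c : ℝ} (hc : c ≠ 0) :
    (u / c * y) * Real.log (u / c * y) =
      c⁻¹ * ((u * Real.log u) * y + u * (y * Real.log y) - Real.log c * (u * y)) := by
  by_cases hu : u = 0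
  · simp [hu]
  by_cases hy : y = 0
  · simp [hy]
  rw [Real.log_mul (div_ne_zero hu hc) hy, Real.log_div hu hc]
  field_simp
  ring

section Law

variable {ℓ : ℕ} {ν : Measure ℝ≥0} [IsProbabilityMeasure ν]

lemma pathProd_eq_of_mem_words_one (w : List (Fin ℓ) → ℝ≥0) {ε : List (Fin ℓ)}
    (hε : ε ∈ words ℓ 1) : pathProd w ε = w ε := by
  have h := mem_words.1 hε
  simp only [pathProd, h, Finset.range_one, Finset.prod_singleton, zero_add]
  rw [List.take_of_length_le h.le]

/-- If `E[Y] = 1` and `Y log Y` is integrable, then so is `W log W`, and `E[W log W] ≤ log ℓ`: the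
function `x ↦ x log x` is superadditive and `Y` is the sum over the letters of the independent
products `W Y' / ℓ`. -/
lemma integrable_mul_log (hℓ : 0 < ℓ) (hν : ∫⁻ x, (x : ℝ≥0∞) ∂ν = 1)
    (hY1 : ∫ w : List (Fin ℓ) → ℝ≥0, (totalMass w : ℝ) ∂(weightLaw ℓ ν) = 1)
    (hYi : Integrable (fun w : List (Fin ℓ) → ℝ≥0 => (totalMass w : ℝ) * Real.log (totalMass w))
      (weightLaw ℓ ν)) :
    Integrable (fun x : ℝ≥0 => (x : ℝ) * Real.log x) ν ∧
      ∫ x : ℝ≥0, (x : ℝ) * Real.log x ∂ν ≤ Real.log ℓ := by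
  set P := weightLaw ℓ ν with hP
  have hℓ0 : (ℓ : ℝ) ≠ 0 := by exact_mod_cast hℓ.ne'
  have hYint : Integrable (fun w : List (Fin ℓ) → ℝ≥0 => (totalMass w : ℝ)) P :=
    integrable_totalMass hℓ hν
  have hYm : Measurable fun w : List (Fin ℓ) → ℝ≥0 => (totalMass w : ℝ) :=
    measurable_totalMass.coe_nnreal_real
  have hlogm : Measurable fun x : ℝ≥0 => (x : ℝ) * Real.log x := by fun_prop
  have hνi : Integrable (fun x : ℝ≥0 => (x : ℝ)) ν :=
    integrable_coe_of_lintegral measurable_id (by simp [hν])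
  have hν1 : ∫ x : ℝ≥0, (x : ℝ) ∂ν = 1 := by
    rw [integral_coe_eq_toReal_lintegral (f := fun x => x) measurable_id, hν]; simp
  have hev : ∀ ε, MeasurePreserving (fun w : List (Fin ℓ) → ℝ≥0 => w ε) P ν := fun ε =>
    measurePreserving_eval_infinitePi (fun _ => ν) ε
  have hsh : ∀ ε, MeasurePreserving (shift ε) P P := measurePreserving_shift (ℓ := ℓ) ν
  -- the weight of a letter is independent of the cascade issued from it
  have hind : ∀ (ε : List (Fin ℓ)) {f : ℝ≥0 → ℝ} {g : ℝ≥0 → ℝ}, Measurable f → Measurable g →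
      IndepFun (fun w => f (w ε)) (fun w => g (totalMass (shift ε w))) P := by
    intro ε f g hf hg
    refine indepFun_of_sigmaWords ν (S := {ε}) (T := {ζ | ε.length < ζ.length}) ?_
      (hf.comp (measurable_eval_sigmaWords rfl)) (hg.comp
        (measurable_totalMass_sigmaWords.comp (measurable_shift_sigmaWords ε fun ζ hζ => ?_)))
    · exact Set.disjoint_singleton_left.2 fun h => lt_irrefl _ (show ε.length < ε.length from h)
    · have := List.length_pos_iff.2 hζ
      simp only [Set.mem_ofPred_eq, List.length_append]; omega
  have hAi : ∀ {f : ℝ≥0 → ℝ} (ε), Integrable f ν → Integrable (fun w => f (w ε)) P :=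
    fun ε hf => (hev ε).integrable_comp_of_integrable hf
  have hBi : ∀ {g : ℝ≥0 → ℝ} (ε), Integrable (fun w => g (totalMass w)) P →
      Integrable (fun w => g (totalMass (shift ε w))) P :=
    fun ε hg => (hsh ε).integrable_comp_of_integrable hg
  have hAint : ∀ {f : ℝ≥0 → ℝ} (ε), Measurable f → ∫ w, f (w ε) ∂P = ∫ x, f x ∂ν := by
    intro f ε hf
    rw [← (hev ε).map_eq, integral_map (hev ε).measurable.aemeasurable hf.aestronglyMeasurable]
  have hBint : ∀ {g : ℝ≥0 → ℝ} (ε), Measurable g →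
      ∫ w, g (totalMass (shift ε w)) ∂P = ∫ w, g (totalMass w) ∂P := by
    intro g ε hg
    conv_rhs => rw [← (hsh ε).map_eq]
    rw [integral_map (f := fun w => g (totalMass w)) (hsh ε).measurable.aemeasurable
      (hg.comp measurable_totalMass).aestronglyMeasurable]
  have huY : ∀ ε, Integrable (fun w : List (Fin ℓ) → ℝ≥0 =>
      (w ε : ℝ) * (totalMass (shift ε w) : ℝ)) P := fun ε =>
    (hind ε measurable_coe_nnreal_real measurable_coe_nnreal_real).integrable_mul (hAi ε hνi)
      (hBi (g := fun x => (x : ℝ)) ε hYint)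
  have huYlog : ∀ ε, Integrable (fun w : List (Fin ℓ) → ℝ≥0 =>
      (w ε : ℝ) * ((totalMass (shift ε w) : ℝ) * Real.log (totalMass (shift ε w)))) P := fun ε =>
    (hind ε measurable_coe_nnreal_real hlogm).integrable_mul (hAi ε hνi)
      (hBi (g := fun x => (x : ℝ) * Real.log x) ε hYi)
  -- `Y` is the sum of the variables `U ε` over the words of length one
  set U : List (Fin ℓ) → (List (Fin ℓ) → ℝ≥0) → ℝ :=
    fun ε w => (w ε : ℝ) / ℓ * (totalMass (shift ε w) : ℝ) with hU
  have hU0 : ∀ ε w, 0 ≤ U ε w := fun ε w => by positivity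
  have hYU : ∀ᵐ w ∂P, (totalMass w : ℝ) = ∑ ε ∈ words ℓ 1, U ε w := by
    filter_upwards [ae_tendsto_partialMass_shift hℓ hν] with w hw
    have h := totalMass_eq_sum hw 1
    rw [h]
    push_cast
    refine Finset.sum_congr rfl fun ε hε => ?_
    rw [pathProd_eq_of_mem_words_one w hε, pow_one]
  have hUi : ∀ ε ∈ words ℓ 1, Integrable (fun w => U ε w * Real.log (U ε w)) P := by
    intro ε hε
    refine Integrable.mono' (g := fun w => 1 + |(totalMass w : ℝ) * Real.log (totalMass w)|)
      ((integrable_const 1).add hYi.abs) ?_ ?_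
    · have h1 : Measurable fun w : List (Fin ℓ) → ℝ≥0 => U ε w :=
        ((measurable_pi_apply ε).coe_nnreal_real.div_const _).mul
          (hYm.comp (measurable_shift ε))
      exact (h1.mul h1.log).aestronglyMeasurable
    · filter_upwards [hYU] with w hw
      rw [Real.norm_eq_abs]
      refine abs_mul_log_le (hU0 ε w) ?_
      rw [hw]
      exact Finset.single_le_sum (f := fun ε => U ε w) (fun δ _ => hU0 δ w) hε
  have hexp : ∀ ε w, U ε w * Real.log (U ε w) = (ℓ : ℝ)⁻¹ *
      (((w ε : ℝ) * Real.log (w ε)) * (totalMass (shift ε w) : ℝ)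
        + (w ε : ℝ) * ((totalMass (shift ε w) : ℝ) * Real.log (totalMass (shift ε w)))
        - Real.log ℓ * ((w ε : ℝ) * (totalMass (shift ε w) : ℝ))) :=
    fun ε w => mul_log_mul_div hℓ0
  have hprodi : ∀ ε ∈ words ℓ 1, Integrable (fun w : List (Fin ℓ) → ℝ≥0 =>
      ((w ε : ℝ) * Real.log (w ε)) * (totalMass (shift ε w) : ℝ)) P := by
    intro ε hε
    have h := (((hUi ε hε).const_mul (ℓ : ℝ)).sub (huYlog ε)).add
      ((huY ε).const_mul (Real.log ℓ))
    refine h.congr (Eventually.of_forall fun w => ?_)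
    simp only [Pi.add_apply, Pi.sub_apply]
    rw [hexp, mul_inv_cancel_left₀ hℓ0]
    ring
  have hWi : Integrable (fun x : ℝ≥0 => (x : ℝ) * Real.log x) ν := by
    -- in the independent product `(W log W) Y'` the factor `Y'` has mean one
    set ε₀ : List (Fin ℓ) := [⟨0, hℓ⟩] with hε₀
    have h := (hprodi ε₀ (mem_words.2 rfl)).2
    refine ⟨hlogm.aestronglyMeasurable, ?_⟩
    rw [HasFiniteIntegral] at h ⊢
    simp_rw [enorm_mul] at h
    have hi : IndepFun (fun w : List (Fin ℓ) → ℝ≥0 => ‖(w ε₀ : ℝ) * Real.log (w ε₀)‖ₑ)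
        (fun w => ‖(totalMass (shift ε₀ w) : ℝ)‖ₑ) P :=
      (hind ε₀ hlogm measurable_coe_nnreal_real).comp measurable_enorm measurable_enorm
    simp_rw [← enorm_mul] at h
    simp_rw [enorm_mul _ ((totalMass (shift ε₀ _) : ℝ≥0) : ℝ)] at h
    have h2 := lintegral_mul_eq_lintegral_mul_lintegral_of_indepFun
      (hlogm.comp (measurable_pi_apply ε₀)).enorm (hYm.comp (measurable_shift ε₀)).enorm hi
    simp only [Pi.mul_apply, Function.comp_apply] at h2
    rw [h2, (hev ε₀).lintegral_comp (f := fun x : ℝ≥0 => ‖(x : ℝ) * Real.log x‖ₑ) hlogm.enorm,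
      (hsh ε₀).lintegral_comp (f := fun w => ‖(totalMass w : ℝ)‖ₑ) hYm.enorm] at h
    have h1 : ∫⁻ w : List (Fin ℓ) → ℝ≥0, ‖(totalMass w : ℝ)‖ₑ ∂P = 1 := by
      rw [← ofReal_integral_norm_eq_lintegral_enorm hYint]
      simp only [NNReal.norm_eq, hY1, ENNReal.ofReal_one]
    rwa [h1, mul_one] at h
  refine ⟨hWi, ?_⟩
  set H := ∫ x : ℝ≥0, (x : ℝ) * Real.log x ∂ν with hH
  set K := ∫ w : List (Fin ℓ) → ℝ≥0, (totalMass w : ℝ) * Real.log (totalMass w) ∂P with hK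
  have hUval : ∀ ε ∈ words ℓ 1, ∫ w, U ε w * Real.log (U ε w) ∂P
      = (ℓ : ℝ)⁻¹ * (H + K - Real.log ℓ) := by
    intro ε hε
    simp_rw [hexp]
    have hadd : Integrable (fun w : List (Fin ℓ) → ℝ≥0 =>
        ((w ε : ℝ) * Real.log (w ε)) * (totalMass (shift ε w) : ℝ)
        + (w ε : ℝ) * ((totalMass (shift ε w) : ℝ) * Real.log (totalMass (shift ε w)))) P :=
      (hprodi ε hε).add (huYlog ε)
    rw [integral_const_mul, integral_sub hadd ((huY ε).const_mul _),
      integral_add (hprodi ε hε) (huYlog ε), integral_const_mul]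
    have e1 := (hind ε hlogm measurable_coe_nnreal_real).integral_fun_mul_eq_mul_integral
      (hAi ε hWi).aestronglyMeasurable (hBi (g := fun x => (x : ℝ)) ε hYint).aestronglyMeasurable
    have e2 := (hind ε measurable_coe_nnreal_real hlogm).integral_fun_mul_eq_mul_integral
      (hAi ε hνi).aestronglyMeasurable
      (hBi (g := fun x => (x : ℝ) * Real.log x) ε hYi).aestronglyMeasurable
    have e3 := (hind ε measurable_coe_nnreal_real
      measurable_coe_nnreal_real).integral_fun_mul_eq_mul_integral
      (hAi ε hνi).aestronglyMeasurable (hBi (g := fun x => (x : ℝ)) ε hYint).aestronglyMeasurable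
    rw [hAint ε hlogm, hBint ε measurable_coe_nnreal_real, hY1] at e1
    rw [hAint ε measurable_coe_nnreal_real, hBint ε hlogm, hν1] at e2
    rw [hAint ε measurable_coe_nnreal_real, hBint ε measurable_coe_nnreal_real, hν1, hY1] at e3
    rw [e1, e2, e3]
    ring
  have hle : ∑ ε ∈ words ℓ 1, ∫ w, U ε w * Real.log (U ε w) ∂P ≤ K := by
    rw [← integral_finsetSum _ hUi]
    refine integral_mono_ae (integrable_finsetSum _ hUi) hYi ?_
    filter_upwards [hYU] with w hw
    rw [hw]
    exact sum_mul_log_le _ _ fun ε _ => hU0 ε w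
  rw [Finset.sum_congr rfl hUval, Finset.sum_const, card_words, nsmul_eq_mul, pow_one,
    mul_inv_cancel_left₀ hℓ0] at hle
  linarith

end Law

/-! ### The size-biased law of the weights along a path -/

/-- The size-biased law `x ν(dx)` of a weight. -/
noncomputable def tilt (ν : Measure ℝ≥0) : Measure ℝ≥0 := ν.withDensity fun x => (x : ℝ≥0∞)

lemma isProbabilityMeasure_tilt {ν : Measure ℝ≥0} (hν : ∫⁻ x, (x : ℝ≥0∞) ∂ν = 1) :
    IsProbabilityMeasure (tilt ν) :=
  ⟨by rw [tilt, withDensity_apply _ MeasurableSet.univ, Measure.restrict_univ, hν]⟩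

lemma pi_tilt {ν : Measure ℝ≥0} [IsProbabilityMeasure ν] (hν : ∫⁻ x, (x : ℝ≥0∞) ∂ν = 1) (n : ℕ) :
    Measure.pi (fun _ : Fin n => tilt ν) =
      (Measure.pi fun _ : Fin n => ν).withDensity fun v => ∏ k, (v k : ℝ≥0∞) := by
  have := isProbabilityMeasure_tilt hν
  refine Measure.pi_eq fun s hs => ?_
  have hm : ∀ k, Measurable ((s k).indicator fun x : ℝ≥0 => (x : ℝ≥0∞)) := fun k =>
    measurable_coe_nnreal_ennreal.indicator (hs k)
  rw [withDensity_apply _ (MeasurableSet.univ_pi hs), ← lintegral_indicator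
    (MeasurableSet.univ_pi hs)]
  have h1 : ∀ v : Fin n → ℝ≥0, (Set.univ.pi s).indicator (fun v => ∏ k, (v k : ℝ≥0∞)) v
      = ∏ k, (s k).indicator (fun x : ℝ≥0 => (x : ℝ≥0∞)) (v k) := by
    intro v
    by_cases hv : v ∈ Set.univ.pi s
    · rw [Set.indicator_of_mem hv]
      exact Finset.prod_congr rfl fun k _ => by rw [Set.indicator_of_mem (hv k trivial)]
    · rw [Set.indicator_of_notMem hv]
      simp only [Set.mem_pi, Set.mem_univ, true_imp_iff, not_forall] at hv
      obtain ⟨k, hk⟩ := hv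
      exact (Finset.prod_eq_zero (Finset.mem_univ k) (Set.indicator_of_notMem hk _)).symm
  simp_rw [h1]
  rw [lintegral_prod_eq_prod_lintegral_of_indepFun Finset.univ
    (fun k (v : Fin n → ℝ≥0) => (s k).indicator (fun x : ℝ≥0 => (x : ℝ≥0∞)) (v k))]
  · refine Finset.prod_congr rfl fun k _ => ?_
    rw [(measurePreserving_eval (fun _ : Fin n => ν) k).lintegral_comp (hm k),
      lintegral_indicator (hs k), tilt, withDensity_apply _ (hs k)]
  · exact iIndepFun_pi (X := fun k => (s k).indicator fun x : ℝ≥0 => (x : ℝ≥0∞))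
      fun k => (hm k).aemeasurable
  · exact fun k => (hm k).comp (measurable_pi_apply k)

/-- The weights read along a word. (Indices beyond the length of the word repeat the weight of the
whole word and play no role.) -/
def prefixWeights {ℓ : ℕ} (w : List (Fin ℓ) → ℝ≥0) (ε : List (Fin ℓ)) (k : ℕ) : ℝ≥0 :=
  w (ε.take (k + 1))

lemma pathProd_take {ℓ : ℕ} (w : List (Fin ℓ) → ℝ≥0) {ε : List (Fin ℓ)} {n : ℕ}
    (hn : n ≤ ε.length) : pathProd w (ε.take n) = ∏ k ∈ Finset.range n, prefixWeights w ε k := by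
  rw [pathProd, List.length_take, min_eq_left hn]
  refine Finset.prod_congr rfl fun k hk => ?_
  have : k < n := Finset.mem_range.1 hk
  rw [prefixWeights, List.take_take, min_eq_left (by omega)]

section Law

variable {ℓ : ℕ} {ν : Measure ℝ≥0} [IsProbabilityMeasure ν]

/-- The many-to-one formula for one word: the weights along the word are tilted by their product,
and the subtree issued from the word is independent of them. -/
lemma lintegral_pathProd_mul (hν : ∫⁻ x, (x : ℝ≥0∞) ∂ν = 1) (ε : List (Fin ℓ))
    {g : (Fin ε.length → ℝ≥0) → ℝ≥0∞} (hg : Measurable g) {h : ℝ≥0 → ℝ≥0∞} (hh : Measurable h) :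
    ∫⁻ w, (pathProd w ε : ℝ≥0∞) * g (fun k => prefixWeights w ε k) * h (totalMass (shift ε w))
      ∂(weightLaw ℓ ν) =
    (∫⁻ v, g v ∂(Measure.pi fun _ : Fin ε.length => tilt ν)) *
      ∫⁻ w, h (totalMass w) ∂(weightLaw ℓ ν) := by
  let G : (Fin ε.length → ℝ≥0) → ℝ≥0∞ := fun v => (∏ k, (v k : ℝ≥0∞)) * g v
  have hprodm : Measurable fun v : Fin ε.length → ℝ≥0 => ∏ k, (v k : ℝ≥0∞) :=
    Finset.measurable_fun_prod _ fun k _ => (measurable_pi_apply k).coe_nnreal_ennreal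
  have hG : Measurable G := hprodm.mul hg
  have hpre : Measurable[sigmaWords {ζ : List (Fin ℓ) | ζ.length ≤ ε.length}]
      fun (w : List (Fin ℓ) → ℝ≥0) (k : Fin ε.length) => prefixWeights w ε k := by
    refine (@measurable_pi_iff _ _ _ (sigmaWords _) _ _).2 fun k =>
      measurable_eval_sigmaWords ?_
    simp only [Set.mem_ofPred_eq, List.length_take]; omega
  have hpre' : Measurable fun (w : List (Fin ℓ) → ℝ≥0) (k : Fin ε.length) =>
    prefixWeights w ε k := hpre.mono (sigmaWords_le _) le_rfl
  have hsub : Measurable[sigmaWords {ζ : List (Fin ℓ) | ε.length < ζ.length}]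
      fun w : List (Fin ℓ) → ℝ≥0 => h (totalMass (shift ε w)) := by
    refine hh.comp (measurable_totalMass_sigmaWords.comp
      (measurable_shift_sigmaWords ε fun ζ hζ => ?_))
    have := List.length_pos_iff.2 hζ
    simp only [Set.mem_ofPred_eq, List.length_append]; omega
  have hind : IndepFun (fun w : List (Fin ℓ) → ℝ≥0 => G fun k => prefixWeights w ε k)
      (fun w => h (totalMass (shift ε w))) (weightLaw ℓ ν) :=
    indepFun_of_sigmaWords ν (Set.disjoint_left.2 fun ζ h1 h2 =>
      not_lt.2 (show ζ.length ≤ ε.length from h1) h2) (hG.comp hpre) hsub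
  have h1 := lintegral_mul_eq_lintegral_mul_lintegral_of_indepFun (hG.comp hpre')
    (hsub.mono (sigmaWords_le _) le_rfl) hind
  simp only [Pi.mul_apply, Function.comp_apply] at h1
  have h2 : ∀ w : List (Fin ℓ) → ℝ≥0, (pathProd w ε : ℝ≥0∞) * g (fun k => prefixWeights w ε k)
      = G fun k => prefixWeights w ε k := by
    intro w
    simp only [G]
    rw [pathProd_eq_prod_fin, ENNReal.ofNNReal_finsetProd]
    rfl
  simp_rw [h2]
  rw [h1]
  congr 1
  · rw [pi_tilt hν, lintegral_withDensity_eq_lintegral_mul _ hprodm hg, ← map_prefixes ν ε]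
    exact (lintegral_map (hprodm.mul hg) hpre').symm
  · exact (measurePreserving_shift ν ε).lintegral_comp (hh.comp measurable_totalMass)

/-- The many-to-one formula. Summing over the words `ε` of length `M`, weighted by
`ℓ⁻ᴹ W_{ε₁} ⋯ W_{ε₁⋯ε_M}`, an event `A` on the `M` weights along `ε` and a function `h` of the total
mass of the subtree gives in mean the product of the probability of `A` for independent size-biased
weights with the mean of `h`. -/
lemma lintegral_sum_words (hℓ : 0 < ℓ) (hν : ∫⁻ x, (x : ℝ≥0∞) ∂ν = 1)
    [IsProbabilityMeasure (tilt ν)] (M : ℕ)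
    {A : Set (ℕ → ℝ≥0)} (hA : MeasurableSet A)
    (hAM : ∀ v v' : ℕ → ℝ≥0, (∀ k < M, v k = v' k) → v ∈ A → v' ∈ A)
    {h : ℝ≥0 → ℝ≥0∞} (hh : Measurable h) :
    ∫⁻ w, ∑ ε ∈ words ℓ M, ((ℓ : ℝ≥0∞) ^ M)⁻¹ * ((pathProd w ε : ℝ≥0∞) *
      A.indicator 1 (prefixWeights w ε) * h (totalMass (shift ε w))) ∂(weightLaw ℓ ν) =
    Measure.infinitePi (fun _ : ℕ => tilt ν) A * ∫⁻ w, h (totalMass w) ∂(weightLaw ℓ ν) := by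
  have hind : Measurable (A.indicator (1 : (ℕ → ℝ≥0) → ℝ≥0∞)) := measurable_one.indicator hA
  have hpm : ∀ ε : List (Fin ℓ), Measurable fun w : List (Fin ℓ) → ℝ≥0 => prefixWeights w ε :=
    fun ε => measurable_pi_lambda _ fun k => measurable_pi_apply _
  have hterm : ∀ ε : List (Fin ℓ), Measurable fun w : List (Fin ℓ) → ℝ≥0 =>
      (pathProd w ε : ℝ≥0∞) * A.indicator 1 (prefixWeights w ε) * h (totalMass (shift ε w)) :=
    fun ε => ((measurable_pathProd ε).coe_nnreal_ennreal.mul (hind.comp (hpm ε))).mul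
      (hh.comp (measurable_totalMass.comp (measurable_shift ε)))
  rw [lintegral_finsetSum _ fun ε _ => (hterm ε).const_mul _]
  have hval : ∀ ε ∈ words ℓ M, ∫⁻ w, ((ℓ : ℝ≥0∞) ^ M)⁻¹ * ((pathProd w ε : ℝ≥0∞) *
      A.indicator 1 (prefixWeights w ε) * h (totalMass (shift ε w))) ∂(weightLaw ℓ ν) =
      ((ℓ : ℝ≥0∞) ^ M)⁻¹ * (Measure.infinitePi (fun _ : ℕ => tilt ν) A *
        ∫⁻ w, h (totalMass w) ∂(weightLaw ℓ ν)) := by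
    intro ε hε
    obtain rfl := mem_words.1 hε
    rw [lintegral_const_mul _ (hterm ε)]
    congr 1
    -- `A` depends only on the first `M` weights, so it can be read off their extension by ones
    let ext : (Fin ε.length → ℝ≥0) → ℕ → ℝ≥0 := fun v k =>
      if hk : k < ε.length then v ⟨k, hk⟩ else 1
    have hext : Measurable ext := by
      refine measurable_pi_lambda _ fun k => ?_
      by_cases hk : k < ε.length
      · simpa only [ext, hk, dite_true] using measurable_pi_apply (⟨k, hk⟩ : Fin ε.length)
      · simp only [ext, hk, dite_false]; exact measurable_const
    have hiff : ∀ u : ℕ → ℝ≥0, A.indicator (1 : (ℕ → ℝ≥0) → ℝ≥0∞) u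
        = A.indicator 1 (ext fun k => u k) := by
      intro u
      have hk : ∀ k < ε.length, u k = ext (fun k => u k) k := fun k hk => by simp [ext, hk]
      have : u ∈ A ↔ ext (fun k => u k) ∈ A :=
        ⟨hAM _ _ hk, hAM _ _ fun k h => (hk k h).symm⟩
      by_cases hu : u ∈ A
      · rw [Set.indicator_of_mem hu, Set.indicator_of_mem (this.1 hu)]; rfl
      · rw [Set.indicator_of_notMem hu, Set.indicator_of_notMem fun h => hu (this.2 h)]
    have h1 := lintegral_pathProd_mul (ν := ν) hν ε (hind.comp hext) hh
    simp only [Function.comp_apply] at h1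
    rw [lintegral_congr fun w => by rw [hiff (prefixWeights w ε)], h1]
    congr 1
    rw [← lintegral_indicator_one hA]
    rw [lintegral_congr hiff]
    have h2 : (Measure.infinitePi fun _ : ℕ => tilt ν).map (fun u (k : Fin ε.length) => u k)
        = Measure.pi fun _ => tilt ν := by
      rw [Measure.map_infinitePi_infinitePi_of_inj (P := fun _ : ℕ => tilt ν)
        Fin.val_injective, Measure.infinitePi_eq_pi]
    have hr : Measurable fun (u : ℕ → ℝ≥0) (k : Fin ε.length) => u k :=
      measurable_pi_lambda _ fun k => measurable_pi_apply (k : ℕ)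
    rw [← h2]
    exact lintegral_map (hind.comp hext) hr
  rw [Finset.sum_congr rfl hval, Finset.sum_const, card_words, nsmul_eq_mul, ← mul_assoc]
  push_cast
  rw [ENNReal.mul_inv_cancel (by positivity) (by finiteness), one_mul]

end Law

/-- The number `p` is within a factor `exp (n δ)` of `exp (n h)`, in both directions. -/
def IsTypical (h δ : ℝ) (n : ℕ) (p : ℝ≥0) : Prop :=
  Real.exp (n * (h - δ)) ≤ p ∧ (p : ℝ) ≤ Real.exp (n * (h + δ))

lemma measurableSet_isTypical (h δ : ℝ) (n : ℕ) : MeasurableSet {p | IsTypical h δ n p} :=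
  (measurableSet_le measurable_const measurable_coe_nnreal_real).inter
    (measurableSet_le measurable_coe_nnreal_real measurable_const)

/-- The strong law of large numbers for the logarithms of independent size-biased weights. -/
lemma ae_isTypical_prod {ν : Measure ℝ≥0} [IsProbabilityMeasure ν] [IsProbabilityMeasure (tilt ν)]
    (hi : Integrable (fun x : ℝ≥0 => (x : ℝ) * Real.log x) ν) {δ : ℝ} (hδ : 0 < δ) :
    ∀ᵐ v ∂(Measure.infinitePi fun _ : ℕ => tilt ν), ∀ᶠ n in atTop,
      IsTypical (∫ x : ℝ≥0, (x : ℝ) * Real.log x ∂ν) δ n (∏ k ∈ Finset.range n, v k) := by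
  set H := ∫ x : ℝ≥0, (x : ℝ) * Real.log x ∂ν with hH
  set Q := Measure.infinitePi fun _ : ℕ => tilt ν with hQ
  have hev : ∀ k, MeasurePreserving (fun v : ℕ → ℝ≥0 => v k) Q (tilt ν) := fun k =>
    measurePreserving_eval_infinitePi (fun _ => tilt ν) k
  have hlog : Measurable fun x : ℝ≥0 => Real.log x := measurable_coe_nnreal_real.log
  have hti : Integrable (fun x : ℝ≥0 => Real.log x) (tilt ν) := by
    rw [tilt, integrable_withDensity_iff_integrable_smul (f := fun x => x) measurable_id]
    exact hi
  have htint : ∫ x : ℝ≥0, Real.log x ∂(tilt ν) = H := by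
    rw [tilt, integral_withDensity_eq_integral_smul (f := fun x => x) measurable_id]
    rfl
  have hslln := strong_law_ae_real (μ := Q) (fun k (v : ℕ → ℝ≥0) => Real.log (v k))
    ((hev 0).integrable_comp_of_integrable hti)
    (fun i j hij => (iIndepFun_infinitePi (P := fun _ : ℕ => tilt ν)
      (X := fun _ (x : ℝ≥0) => Real.log x) fun _ => hlog).indepFun hij)
    (fun k => ⟨(hlog.comp (hev k).measurable).aemeasurable,
      (hlog.comp (hev 0).measurable).aemeasurable, by
        change Q.map ((fun x : ℝ≥0 => Real.log x) ∘ fun v : ℕ → ℝ≥0 => v k)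
          = Q.map ((fun x : ℝ≥0 => Real.log x) ∘ fun v : ℕ → ℝ≥0 => v 0)
        rw [← Measure.map_map hlog (hev k).measurable, ← Measure.map_map hlog (hev 0).measurable,
          (hev k).map_eq, (hev 0).map_eq]⟩)
  have hmean : ∫ v : ℕ → ℝ≥0, Real.log (v 0) ∂Q = H := by
    rw [← htint, ← (hev 0).map_eq, integral_map (hev 0).measurable.aemeasurable
      hlog.aestronglyMeasurable]
  rw [hmean] at hslln
  -- a size-biased weight does not vanish
  have hpos : ∀ᵐ v ∂Q, ∀ k, v k ≠ 0 := by
    refine ae_all_iff.2 fun k => (hev k).quasiMeasurePreserving.ae (p := fun x => x ≠ 0) ?_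
    rw [tilt, ae_withDensity_iff measurable_coe_nnreal_ennreal]
    exact Eventually.of_forall fun x hx => by simpa using hx
  filter_upwards [hslln, hpos] with v hv hv0
  have h1 : ∀ᶠ n : ℕ in atTop, |(∑ k ∈ Finset.range n, Real.log (v k)) / n - H| < δ := by
    have := (Metric.tendsto_nhds.1 hv) δ hδ
    simpa only [Real.dist_eq] using this
  filter_upwards [h1, eventually_gt_atTop 0] with n hn hn0
  have hnR : (0 : ℝ) < n := by exact_mod_cast hn0
  have hprod : (((∏ k ∈ Finset.range n, v k : ℝ≥0)) : ℝ)
      = Real.exp (∑ k ∈ Finset.range n, Real.log (v k)) := by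
    rw [Real.exp_sum, NNReal.coe_prod]
    refine Finset.prod_congr rfl fun k _ => ?_
    rw [Real.exp_log (NNReal.coe_pos.2 (pos_iff_ne_zero.2 (hv0 k)))]
  rw [abs_lt, sub_lt_iff_lt_add', lt_sub_iff_add_lt', div_lt_iff₀ hnR, lt_div_iff₀ hnR] at hn
  rw [IsTypical, hprod, Real.exp_le_exp, Real.exp_le_exp]
  constructor <;> nlinarith [hn.1, hn.2]

/-! ### Almost sure local dimension of the cascade -/

lemma measure_biUnion_ival {ℓ : ℕ} (μ : Measure ℝ) (M : ℕ) (C : Set (List (Fin ℓ))) :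
    μ (⋃ ε ∈ (words ℓ M : Set (List (Fin ℓ))) ∩ C, ival ε) =
      ∑ ε ∈ words ℓ M, C.indicator (fun ε => μ (ival ε)) ε := by
  classical
  have h : (words ℓ M : Set (List (Fin ℓ))) ∩ C = ((words ℓ M).filter (· ∈ C) : Finset _) := by
    ext ε; simp
  rw [h]
  simp only [Finset.mem_coe]
  rw [measure_biUnion_finset]
  · rw [Finset.sum_filter]
    exact Finset.sum_congr rfl fun ε _ => by simp [Set.indicator_apply]
  · intro ε hε η hη hne
    exact disjoint_ival ((mem_words.1 (Finset.mem_filter.1 hε).1).trans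
      (mem_words.1 (Finset.mem_filter.1 hη).1).symm) hne
  · exact fun ε _ => measurableSet_ival ε

section Law

variable {ℓ : ℕ} {ν : Measure ℝ≥0} [IsProbabilityMeasure ν]

/-- The mass formula of `ae_cascadeNN`, in a form suited to the many-to-one formula. -/
lemma measure_ival_eq_inv_pow_mul (hℓ : 0 < ℓ) {w : List (Fin ℓ) → ℝ≥0} {M : ℕ} {ε : List (Fin ℓ)}
    (hε : ε ∈ words ℓ M) {μ : Measure ℝ} (hw : μ (ival ε) =
      ((pathProd w ε / (ℓ : ℝ≥0) ^ ε.length * totalMass (shift ε w) : ℝ≥0) : ℝ≥0∞)) :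
    μ (ival ε) = ((ℓ : ℝ≥0∞) ^ M)⁻¹ * ((pathProd w ε : ℝ≥0∞) * totalMass (shift ε w)) := by
  have hℓ0 : (ℓ : ℝ≥0) ≠ 0 := by exact_mod_cast hℓ.ne'
  rw [hw, mem_words.1 hε, ENNReal.coe_mul, ENNReal.coe_div (pow_ne_zero _ hℓ0), div_eq_mul_inv]
  push_cast
  ring

/-- Almost surely, for almost every point of the cascade measure, the products of the weights along
the word of the point are `exp (n (E[W log W] + o(1)))`. -/
lemma ae_isTypical_pathProd (hℓ : 2 ≤ ℓ) (hν : ∫⁻ x, (x : ℝ≥0∞) ∂ν = 1)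
    (hi : Integrable (fun x : ℝ≥0 => (x : ℝ) * Real.log x) ν) {δ : ℝ} (hδ : 0 < δ) :
    ∀ᵐ w : List (Fin ℓ) → ℝ≥0 ∂(weightLaw ℓ ν), ∀ᵐ x ∂(cascadeNN w : Measure ℝ), ∀ᶠ n in atTop,
      ∀ ε ∈ words ℓ n, x ∈ ival ε →
        IsTypical (∫ x : ℝ≥0, (x : ℝ) * Real.log x ∂ν) δ n (pathProd w ε) := by
  have hℓ0 : 0 < ℓ := by omega
  have := isProbabilityMeasure_tilt hν
  set H := ∫ x : ℝ≥0, (x : ℝ) * Real.log x ∂ν with hH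
  set Q := Measure.infinitePi fun _ : ℕ => tilt ν with hQ
  -- sequences of weights that are atypical at some time between `N` and `M`
  let A : ℕ → ℕ → Set (ℕ → ℝ≥0) := fun N M =>
    {v | ∃ n, N ≤ n ∧ n ≤ M ∧ ¬ IsTypical H δ n (∏ k ∈ Finset.range n, v k)}
  have hAm1 : ∀ n, MeasurableSet {v : ℕ → ℝ≥0 | ¬ IsTypical H δ n (∏ k ∈ Finset.range n, v k)} := by
    intro n
    have hp : Measurable fun v : ℕ → ℝ≥0 => ∏ k ∈ Finset.range n, v k :=
      Finset.measurable_fun_prod _ fun k _ => measurable_pi_apply k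
    exact (hp (measurableSet_isTypical H δ n)).compl
  have hAm : ∀ N M, MeasurableSet (A N M) := by
    intro N M
    have : A N M = ⋃ n ∈ Set.Icc N M,
        {v : ℕ → ℝ≥0 | ¬ IsTypical H δ n (∏ k ∈ Finset.range n, v k)} := by
      ext v; simp [A, and_assoc]
    rw [this]
    exact MeasurableSet.biUnion (Set.to_countable _) fun n _ => hAm1 n
  have hAdep : ∀ N M (v v' : ℕ → ℝ≥0), (∀ k < M, v k = v' k) → v ∈ A N M → v' ∈ A N M := by
    rintro N M v v' hvv ⟨n, h1, h2, h3⟩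
    refine ⟨n, h1, h2, ?_⟩
    rwa [← Finset.prod_congr rfl fun k hk => hvv k ((Finset.mem_range.1 hk).trans_le h2)]
  let A' : ℕ → Set (ℕ → ℝ≥0) := fun N =>
    ⋃ n ∈ Set.Ici N, {v | ¬ IsTypical H δ n (∏ k ∈ Finset.range n, v k)}
  have hAA' : ∀ N M, A N M ⊆ A' N := fun N M v ⟨n, h1, _, h3⟩ => Set.mem_iUnion₂.2 ⟨n, h1, h3⟩
  have he : Tendsto (fun N => Q (A' N)) atTop (𝓝 0) := by
    have h0 : Q (⋂ N, A' N) = 0 := by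
      refine measure_mono_null ?_ (ae_isTypical_prod hi hδ)
      intro v hv hv2
      obtain ⟨N, hN⟩ := eventually_atTop.1 hv2
      obtain ⟨n, hn, h⟩ := Set.mem_iUnion₂.1 (Set.mem_iInter.1 hv N)
      exact h (hN n hn)
    rw [← h0]
    refine tendsto_measure_iInter_atTop (fun N => (MeasurableSet.biUnion (Set.to_countable _)
      fun n _ => hAm1 n).nullMeasurableSet) ?_ ⟨0, measure_ne_top _ _⟩
    exact fun N N' hN => Set.biUnion_subset_biUnion_left (Set.Ici_subset_Ici.2 hN)
  -- `T N M` is the mass of the intervals of generation `M` with an atypical prefix; by the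
  -- many-to-one formula its mean is at most the tail probability `Q (A' N)`
  let T : ℕ → ℕ → (List (Fin ℓ) → ℝ≥0) → ℝ≥0∞ := fun N M w =>
    ∑ ε ∈ words ℓ M, ((ℓ : ℝ≥0∞) ^ M)⁻¹ * ((pathProd w ε : ℝ≥0∞) *
      (A N M).indicator 1 (prefixWeights w ε) * (totalMass (shift ε w) : ℝ≥0∞))
  have hTm : ∀ N M, Measurable (T N M) := by
    intro N M
    have h1 : Measurable ((A N M).indicator (1 : (ℕ → ℝ≥0) → ℝ≥0∞)) :=
      measurable_one.indicator (hAm N M)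
    have h2 : ∀ ε : List (Fin ℓ), Measurable fun w : List (Fin ℓ) → ℝ≥0 => prefixWeights w ε :=
      fun ε => measurable_pi_lambda _ fun k => measurable_pi_apply (ε.take (k + 1))
    exact Finset.measurable_fun_sum _ fun ε _ => Measurable.const_mul
      (((measurable_pathProd ε).coe_nnreal_ennreal.mul (h1.comp (h2 ε))).mul
        (measurable_totalMass.comp (measurable_shift ε)).coe_nnreal_ennreal) _
  have hTint : ∀ N M, ∫⁻ w, T N M w ∂(weightLaw ℓ ν) ≤ Q (A' N) := by
    intro N M
    rw [lintegral_sum_words (ℓ := ℓ) hℓ0 hν M (hAm N M) (hAdep N M) measurable_coe_nnreal_ennreal]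
    calc _ ≤ Q (A' N) * 1 := mul_le_mul' (measure_mono (hAA' N M)) (lintegral_totalMass_le hℓ0 hν)
      _ = Q (A' N) := mul_one _
  have hD := ae_iInf_eq_zero_of_lintegral_le (μ := weightLaw ℓ ν)
    (f := fun N w => liminf (fun M => T N M w) atTop)
    (fun N => Measurable.liminf fun M => hTm N M) he fun N => by
      refine (lintegral_liminf_le fun M => hTm N M).trans ?_
      refine (liminf_le_liminf (Eventually.of_forall fun M => hTint N M)).trans ?_
      rw [liminf_const]
  filter_upwards [hD, ae_cascadeNN hℓ hν] with w hw ⟨_, hw2, hw3⟩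
  set μ : Measure ℝ := (cascadeNN w : Measure ℝ) with hμ
  let B : ℕ → ℕ → Set ℝ := fun N M =>
    ⋃ ε ∈ (words ℓ M : Set (List (Fin ℓ))) ∩ {ε | prefixWeights w ε ∈ A N M}, ival ε
  have hBT : ∀ N M, μ (B N M) = T N M w := by
    intro N M
    rw [measure_biUnion_ival]
    refine Finset.sum_congr rfl fun ε hε => ?_
    by_cases h : prefixWeights w ε ∈ A N M
    · rw [Set.indicator_of_mem (s := {ε | prefixWeights w ε ∈ A N M}) h, Set.indicator_of_mem h,
        measure_ival_eq_inv_pow_mul hℓ0 hε (hw3 ε), Pi.one_apply, mul_one]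
    · rw [Set.indicator_of_notMem (s := {ε | prefixWeights w ε ∈ A N M}) h,
        Set.indicator_of_notMem h]
      simp
  have hBmono : ∀ N, Monotone (B N) := by
    intro N
    refine monotone_nat_of_le_succ fun M x hx => ?_
    obtain ⟨ε, ⟨hε, n, h1, h2, h3⟩, hxε⟩ := Set.mem_iUnion₂.1 hx
    obtain ⟨η, hη, hxη⟩ := exists_mem_ival hℓ0 (M + 1) (ival_subset _ hxε)
    have hlε := mem_words.1 (Finset.mem_coe.1 hε)
    have hlη := mem_words.1 hη
    have hpre : η.take M = ε := by
      refine eq_of_mem_ival (by rw [List.length_take]; omega) ?_ hxε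
      exact ival_append_subset (η.take M) (η.drop M) (by rwa [List.take_append_drop])
    refine Set.mem_iUnion₂.2 ⟨η, ⟨Finset.mem_coe.2 hη, n, h1, h2.trans M.le_succ, ?_⟩, hxη⟩
    rw [← pathProd_take w (by omega : n ≤ ε.length)] at h3
    rw [← pathProd_take w (by omega : n ≤ η.length)]
    rwa [← hpre, List.take_take, min_eq_left h2] at h3
  have hlim : ∀ N, μ (⋃ M, B N M) = liminf (fun M => T N M w) atTop := by
    intro N
    have := tendsto_measure_iUnion_atTop (μ := μ) (hBmono N)
    simp_rw [Function.comp_def, hBT] at this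
    exact this.liminf_eq.symm
  have hnull : μ (⋂ N, ⋃ M, B N M) = 0 := by
    refine le_antisymm ?_ bot_le
    rw [← hw]
    exact le_iInf fun N => (measure_mono (Set.iInter_subset _ N)).trans (hlim N).le
  refine measure_mono_null ?_ (measure_union_null hw2 hnull)
  intro x hx
  by_cases hx1 : x ∈ Set.Ico (0 : ℝ) 1
  swap
  · exact Or.inl hx1
  right
  refine Set.mem_iInter.2 fun N => ?_
  by_contra hcon
  refine hx (eventually_atTop.2 ⟨N, fun n hn ε hε hxε => ?_⟩)
  by_contra hbad
  refine hcon (Set.mem_iUnion.2 ⟨n, Set.mem_iUnion₂.2 ⟨ε, ⟨Finset.mem_coe.2 hε, n, hn, le_rfl, ?_⟩,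
    hxε⟩⟩)
  have hl := mem_words.1 hε
  rwa [← pathProd_take w hl.ge, List.take_of_length_le hl.le]

/-- The bound `∑ₙ y 1_{|log y| > n δ} ≤ |y log y| / δ + y`. -/
lemma tsum_indicator_not_isTypical_le {δ : ℝ} (hδ : 0 < δ) (y : ℝ≥0) :
    ∑' n : ℕ, {y : ℝ≥0 | ¬ IsTypical 0 δ n y}.indicator (fun y => (y : ℝ≥0∞)) y ≤
      ENNReal.ofReal (|(y : ℝ) * Real.log y| / δ + y) := by
  rcases eq_or_ne y 0 with rfl | hy
  · have : ∀ n : ℕ, {y : ℝ≥0 | ¬ IsTypical 0 δ n y}.indicator (fun y => (y : ℝ≥0∞)) 0 = 0 := by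
      intro n; simp
    simp [this]
  have hy0 : (0 : ℝ) < y := NNReal.coe_pos.2 (pos_iff_ne_zero.2 hy)
  set t : ℝ := |Real.log y| / δ with ht
  have hzero : ∀ n ∉ Finset.range ⌈t⌉₊,
      {y : ℝ≥0 | ¬ IsTypical 0 δ n y}.indicator (fun y => (y : ℝ≥0∞)) y = 0 := by
    intro n hn
    rw [Finset.mem_range, not_lt] at hn
    have h1 : |Real.log y| ≤ n * δ := by
      rw [← div_le_iff₀ hδ]; exact Nat.ceil_le.1 hn
    have h2 := abs_le.1 h1
    have h3 : IsTypical 0 δ n y := by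
      rw [IsTypical, ← Real.le_log_iff_exp_le hy0, ← Real.log_le_iff_le_exp hy0]
      constructor <;> linarith [h2.1, h2.2]
    exact Set.indicator_of_notMem (not_not.2 h3) _
  rw [tsum_eq_sum hzero]
  calc ∑ n ∈ Finset.range ⌈t⌉₊, {y : ℝ≥0 | ¬ IsTypical 0 δ n y}.indicator (fun y => (y : ℝ≥0∞)) y
      ≤ ∑ n ∈ Finset.range ⌈t⌉₊, (y : ℝ≥0∞) :=
        Finset.sum_le_sum fun n _ => Set.indicator_le_self' (fun _ _ => bot_le) y
    _ = (⌈t⌉₊ : ℝ≥0∞) * y := by simp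
    _ = ENNReal.ofReal (⌈t⌉₊ * y) := by
        rw [ENNReal.ofReal_mul (by positivity), ENNReal.ofReal_natCast, ENNReal.ofReal_coe_nnreal]
    _ ≤ ENNReal.ofReal (|(y : ℝ) * Real.log y| / δ + y) := by
        apply ENNReal.ofReal_le_ofReal
        have h1 : (⌈t⌉₊ : ℝ) ≤ t + 1 := (Nat.ceil_lt_add_one (by positivity)).le
        calc (⌈t⌉₊ : ℝ) * y ≤ (t + 1) * y := by gcongr
          _ = |(y : ℝ) * Real.log y| / δ + y := by
            rw [abs_mul, abs_of_pos hy0, ht]; ring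

/-- Almost surely, for almost every point of the cascade measure, the total masses of the subtrees
met along the word of the point are sub-exponential. -/
lemma ae_isTypical_totalMass (hℓ : 2 ≤ ℓ) (hν : ∫⁻ x, (x : ℝ≥0∞) ∂ν = 1)
    (hYi : Integrable (fun w : List (Fin ℓ) → ℝ≥0 => (totalMass w : ℝ) * Real.log (totalMass w))
      (weightLaw ℓ ν)) {δ : ℝ} (hδ : 0 < δ) :
    ∀ᵐ w : List (Fin ℓ) → ℝ≥0 ∂(weightLaw ℓ ν), ∀ᵐ x ∂(cascadeNN w : Measure ℝ), ∀ᶠ n in atTop,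
      ∀ ε ∈ words ℓ n, x ∈ ival ε → IsTypical 0 δ n (totalMass (shift ε w)) := by
  have hℓ0 : 0 < ℓ := by omega
  have := isProbabilityMeasure_tilt hν
  let h : ℕ → ℝ≥0 → ℝ≥0∞ := fun n =>
    {y : ℝ≥0 | ¬ IsTypical 0 δ n y}.indicator fun y => (y : ℝ≥0∞)
  have hh : ∀ n, Measurable (h n) := fun n =>
    measurable_coe_nnreal_ennreal.indicator (measurableSet_isTypical 0 δ n).compl
  -- `T n` is the mass of the intervals of generation `n` with an atypical subtree; the sum over `n`
  -- of its means is finite, and the Borel–Cantelli lemma applies to the cascade measure itself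
  let T : ℕ → (List (Fin ℓ) → ℝ≥0) → ℝ≥0∞ := fun n w =>
    ∑ ε ∈ words ℓ n, ((ℓ : ℝ≥0∞) ^ n)⁻¹ * ((pathProd w ε : ℝ≥0∞) *
      (Set.univ : Set (ℕ → ℝ≥0)).indicator 1 (prefixWeights w ε) * h n (totalMass (shift ε w)))
  have hTm : ∀ n, Measurable (T n) := by
    intro n
    refine Finset.measurable_fun_sum _ fun ε _ => Measurable.const_mul (Measurable.mul ?_
      ((hh n).comp (measurable_totalMass.comp (measurable_shift ε)))) _
    simp only [Set.indicator_univ, Pi.one_apply, mul_one]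
    exact (measurable_pathProd ε).coe_nnreal_ennreal
  have hTint : ∀ n, ∫⁻ w, T n w ∂(weightLaw ℓ ν) = ∫⁻ w, h n (totalMass w) ∂(weightLaw ℓ ν) := by
    intro n
    rw [lintegral_sum_words hℓ0 hν n MeasurableSet.univ (fun _ _ _ h => h) (hh n), measure_univ,
      one_mul]
  have hsum : ∫⁻ w, ∑' n, T n w ∂(weightLaw ℓ ν) ≠ ∞ := by
    rw [lintegral_tsum fun n => (hTm n).aemeasurable]
    simp_rw [hTint]
    rw [← lintegral_tsum (f := fun n w => h n (totalMass w))
      fun n => ((hh n).comp measurable_totalMass).aemeasurable]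
    have hint : Integrable (fun w : List (Fin ℓ) → ℝ≥0 =>
        |(totalMass w : ℝ) * Real.log (totalMass w)| / δ + totalMass w) (weightLaw ℓ ν) :=
      (hYi.abs.div_const δ).add (integrable_totalMass hℓ0 hν)
    refine ne_top_of_le_ne_top hint.lintegral_lt_top.ne
      (lintegral_mono fun w => tsum_indicator_not_isTypical_le hδ (totalMass w))
  filter_upwards [ae_lt_top (Measurable.tsum hTm) hsum, ae_cascadeNN hℓ hν]
    with w hw ⟨_, hw2, hw3⟩
  set μ : Measure ℝ := (cascadeNN w : Measure ℝ) with hμ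
  let B : ℕ → Set ℝ := fun n => ⋃ ε ∈ (words ℓ n : Set (List (Fin ℓ))) ∩
    {ε | ¬ IsTypical 0 δ n (totalMass (shift ε w))}, ival ε
  have hBT : ∀ n, μ (B n) = T n w := by
    intro n
    rw [measure_biUnion_ival]
    refine Finset.sum_congr rfl fun ε hε => ?_
    rw [Set.indicator_univ, Pi.one_apply, mul_one]
    by_cases hb : IsTypical 0 δ n (totalMass (shift ε w))
    · rw [Set.indicator_of_notMem (by simpa using hb)]
      simp only [h]
      rw [Set.indicator_of_notMem (by simpa using hb)]
      simp
    · rw [Set.indicator_of_mem (by simpa using hb)]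
      simp only [h]
      rw [Set.indicator_of_mem (by simpa using hb), measure_ival_eq_inv_pow_mul hℓ0 hε (hw3 ε)]
  have hBC : ∀ᵐ x ∂μ, ∀ᶠ n in atTop, x ∉ B n :=
    ae_eventually_notMem (by simp_rw [hBT]; exact hw.ne)
  filter_upwards [hBC] with x hx
  filter_upwards [hx] with n hn ε hε hxε
  by_contra hb
  exact hn (Set.mem_iUnion₂.2 ⟨ε, ⟨Finset.mem_coe.2 hε, hb⟩, hxε⟩)

lemma exp_div_pow_eq_rpow {b : ℝ} (hb : 1 < b) (n : ℕ) (a : ℝ) :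
    Real.exp (n * a) / b ^ n = b ^ (-(n * (1 - a / Real.log b))) := by
  have hb0 : 0 < b := by linarith
  have hlog : Real.log b ≠ 0 := (Real.log_pos hb).ne'
  rw [Real.rpow_def_of_pos hb0, ← Real.exp_log (pow_pos hb0 n), Real.log_pow, ← Real.exp_sub]
  congr 1
  field_simp
  ring

/-- Almost surely the local dimension of the cascade measure along `ℓ`-adic intervals is almost
everywhere `1 - E[W log W] / log ℓ`. -/
lemma ae_cellMass_cascadeNN (hℓ : 2 ≤ ℓ) (hν : ∫⁻ x, (x : ℝ≥0∞) ∂ν = 1)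
    (hY1 : ∫ w : List (Fin ℓ) → ℝ≥0, (totalMass w : ℝ) ∂(weightLaw ℓ ν) = 1)
    (hYi : Integrable (fun w : List (Fin ℓ) → ℝ≥0 => (totalMass w : ℝ) * Real.log (totalMass w))
      (weightLaw ℓ ν)) {δ : ℝ} (hδ : 0 < δ) {d : ℝ}
    (hd : d = 1 - (∫ x : ℝ≥0, (x : ℝ) * Real.log x ∂ν) / Real.log ℓ) :
    ∀ᵐ w : List (Fin ℓ) → ℝ≥0 ∂(weightLaw ℓ ν), ∀ᵐ x ∂(cascadeNN w : Measure ℝ),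
      ∀ᶠ n : ℕ in atTop,
        ENNReal.ofReal ((ℓ : ℝ) ^ (-(n * (d + δ)))) ≤ cellMass ℓ (cascadeNN w) n x ∧
        cellMass ℓ (cascadeNN w) n x ≤ ENNReal.ofReal ((ℓ : ℝ) ^ (-(n * (d - δ)))) := by
  have hℓ0 : 0 < ℓ := by omega
  have hℓR : (1 : ℝ) < ℓ := by exact_mod_cast hℓ
  have hlog := Real.log_pos hℓR
  set H := ∫ x : ℝ≥0, (x : ℝ) * Real.log x ∂ν with hH
  -- each of the two factors is allowed half of the deviation
  set κ : ℝ := δ * Real.log ℓ / 2 with hκ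
  have hκ0 : 0 < κ := by positivity
  have hi := (integrable_mul_log hℓ0 hν hY1 hYi).1
  filter_upwards [ae_isTypical_pathProd hℓ hν hi hκ0, ae_isTypical_totalMass hℓ hν hYi hκ0,
    ae_cascadeNN hℓ hν] with w h1 h2 ⟨_, h3, h4⟩
  have h5 : ∀ᵐ x ∂(cascadeNN w : Measure ℝ), x ∈ Set.Ico (0 : ℝ) 1 := h3
  filter_upwards [h1, h2, h5] with x hx1 hx2 hx3
  filter_upwards [hx1, hx2] with n hn1 hn2
  obtain ⟨ε, hε, hxε⟩ := exists_mem_ival hℓ0 n hx3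
  obtain ⟨a1, a2⟩ := hn1 ε hε hxε
  obtain ⟨b1, b2⟩ := hn2 ε hε hxε
  have hcell : cellMass ℓ (cascadeNN w) n x = (cascadeNN w : Measure ℝ) (ival ε) := by
    obtain ⟨a, ha⟩ := exists_ival_eq_cell ε
    rw [mem_words.1 hε] at ha
    rw [ha] at hxε ⊢
    rw [cellMass, show ⌊x * (ℓ : ℝ) ^ n⌋ = a from hxε]
  rw [hcell, h4 ε, mem_words.1 hε, ← ENNReal.ofReal_coe_nnreal]
  push_cast
  have e1 : (ℓ : ℝ) ^ (-(n * (d + δ))) = Real.exp (n * (H - κ)) / (ℓ : ℝ) ^ n *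
      Real.exp (n * (0 - κ)) := by
    rw [div_mul_eq_mul_div, ← Real.exp_add, ← mul_add, exp_div_pow_eq_rpow hℓR, hd, hκ]
    congr 3
    field_simp
    ring
  have e2 : (ℓ : ℝ) ^ (-(n * (d - δ))) = Real.exp (n * (H + κ)) / (ℓ : ℝ) ^ n *
      Real.exp (n * (0 + κ)) := by
    rw [div_mul_eq_mul_div, ← Real.exp_add, ← mul_add, exp_div_pow_eq_rpow hℓR, hd, hκ]
    congr 3
    field_simp
    ring
  rw [e1, e2]
  constructor <;> apply ENNReal.ofReal_le_ofReal <;> gcongr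

end Law

/-! ### From independent copies to the product space -/

lemma take_succ_ne_nil {ℓ : ℕ} {ε : List (Fin ℓ)} {k : ℕ} (hk : k < ε.length) :
    ε.take (k + 1) ≠ [] := by
  rw [← List.length_pos_iff, List.length_take]; omega

/-- The weight of the empty word plays no role in the approximations. -/
lemma approx_congr {ℓ : ℕ} {w w' : List (Fin ℓ) → ℝ} (h : ∀ ε, ε ≠ [] → w ε = w' ε) :
    approx w = approx w' := by
  have h1 : ∀ n, density w n = density w' n := by
    intro n
    ext x
    refine Finset.sum_congr rfl fun ε _ => ?_
    have : weightProd w ε = weightProd w' ε := Finset.prod_congr rfl fun k hk =>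
      h _ (take_succ_ne_nil (by simpa using hk))
    rw [this]
  ext1 n
  apply Subtype.ext
  simp only [approx, h1]

lemma cascade_congr {ℓ : ℕ} {w w' : List (Fin ℓ) → ℝ} (h : ∀ ε, ε ≠ [] → w ε = w' ε) :
    cascade w = cascade w' := by
  unfold cascade
  rw [approx_congr h]

lemma totalMass_congr {ℓ : ℕ} {w w' : List (Fin ℓ) → ℝ≥0} (h : ∀ ε, ε ≠ [] → w ε = w' ε) :
    totalMass w = totalMass w' := by
  have h1 : ∀ n, partialMass n w = partialMass n w' := fun n =>
    Finset.sum_congr rfl fun ε _ => by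
      rw [pathProd, pathProd, Finset.prod_congr rfl fun k hk =>
        h _ (take_succ_ne_nil (Finset.mem_range.1 hk))]
  simp only [totalMass, h1]

section Transfer

variable {Ω : Type*} [MeasurableSpace Ω] {P : Measure Ω} {ℓ : ℕ} {ν : Measure ℝ≥0}
  {X : List (Fin ℓ) → Ω → ℝ}

/-- The weights `X ε ω`, with an additional value `z` for the empty word. -/
noncomputable def addRoot (X : List (Fin ℓ) → Ω → ℝ) (x : Ω × ℝ≥0) (ε : List (Fin ℓ)) : ℝ≥0 :=
  if ε = [] then x.2 else (X ε x.1).toNNReal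

lemma aemeasurable_addRoot (hX : ∀ ε, ε ≠ [] → AEMeasurable (X ε) P) :
    AEMeasurable (addRoot X) (P.prod ν) := by
  refine aemeasurable_pi_iff.2 fun ε => ?_
  by_cases h : ε = []
  · simp only [addRoot, h, if_true]
    exact measurable_snd.aemeasurable
  · simp only [addRoot, h, if_false]
    exact (hX ε h).real_toNNReal.comp_fst

variable [IsProbabilityMeasure ν]

/-- Adding an independent weight at the empty word yields the product law `weightLaw`. -/
lemma map_addRoot (hX : ∀ ε, ε ≠ [] → AEMeasurable (X ε) P)
    (hlaw : ∀ ε, ε ≠ [] → P.map (fun ω => (X ε ω).toNNReal) = ν)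
    (hind : iIndepFun (fun ε : {ε : List (Fin ℓ) // ε ≠ []} => X ε.1) P) :
    (P.prod ν).map (addRoot X) = weightLaw ℓ ν := by
  classical
  refine Measure.eq_infinitePi _ fun s t ht => ?_
  rw [Measure.map_apply_of_aemeasurable (aemeasurable_addRoot hX)
    (MeasurableSet.pi s.countable_toSet fun ε _ => ht ε)]
  have hpre : addRoot X ⁻¹' (s : Set (List (Fin ℓ))).pi t =
      (⋂ ε ∈ s.subtype (· ≠ []), (fun ω => (X ε.1 ω).toNNReal) ⁻¹' t ε.1) ×ˢ
        {z | [] ∈ s → z ∈ t []} := by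
    ext ⟨ω, z⟩
    simp only [Set.mem_preimage, Set.mem_pi, Finset.mem_coe, Set.mem_prod, Set.mem_iInter,
      Finset.mem_subtype, Set.mem_ofPred_eq, Subtype.forall]
    constructor
    · intro h
      refine ⟨fun ε hne hε => ?_, fun hnil => ?_⟩
      · simpa [addRoot, hne] using h ε hε
      · simpa [addRoot] using h [] hnil
    · rintro ⟨h1, h2⟩ ε hε
      by_cases hne : ε = []
      · subst hne; simpa [addRoot] using h2 hε
      · simpa [addRoot, hne] using h1 ε hne hε
  have hind' : iIndepFun (fun (ε : {ε : List (Fin ℓ) // ε ≠ []}) ω => (X ε.1 ω).toNNReal) P :=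
    hind.comp (fun _ x => x.toNNReal) fun _ => measurable_real_toNNReal
  have h1 : P (⋂ ε ∈ s.subtype (· ≠ []), (fun ω => (X ε.1 ω).toNNReal) ⁻¹' t ε.1)
      = ∏ ε ∈ s with ε ≠ [], ν (t ε) := by
    rw [hind'.measure_inter_preimage_eq_mul (s.subtype (· ≠ [])) (sets := fun ε => t ε.1)
      (fun ε _ => ht ε.1), ← Finset.prod_subtype_eq_prod_filter (f := fun ε => ν (t ε))]
    refine Finset.prod_congr rfl fun ε _ => ?_
    rw [← hlaw ε.1 ε.2, Measure.map_apply_of_aemeasurable (hX ε.1 ε.2).real_toNNReal (ht ε.1)]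
  rw [hpre, Measure.prod_prod, h1, ← Finset.prod_filter_mul_prod_filter_not s (· ≠ [])]
  congr 1
  by_cases hnil : [] ∈ s
  · have hs : s.filter (fun ε => ¬ ε ≠ []) = {[]} := by
      ext ε; simp only [Finset.mem_filter, not_not, Finset.mem_singleton]
      exact ⟨fun h => h.2, fun h => ⟨h ▸ hnil, h⟩⟩
    rw [hs, Finset.prod_singleton]
    simp [hnil]
  · have hs : s.filter (fun ε => ¬ ε ≠ []) = ∅ :=
      Finset.filter_eq_empty_iff.2 fun ε hε h => hnil (not_not.1 h ▸ hε)
    rw [hs, Finset.prod_empty]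
    simp [hnil]

/-- An almost sure property of the product law `weightLaw` that does not involve the weight of the
empty word holds almost surely for independent copies. -/
lemma ae_of_ae_weightLaw (hX : ∀ ε, ε ≠ [] → AEMeasurable (X ε) P)
    (hlaw : ∀ ε, ε ≠ [] → P.map (fun ω => (X ε ω).toNNReal) = ν)
    (hind : iIndepFun (fun ε : {ε : List (Fin ℓ) // ε ≠ []} => X ε.1) P)
    (hpos : ∀ ε, ε ≠ [] → ∀ᵐ ω ∂P, 0 ≤ X ε ω) {p : (List (Fin ℓ) → ℝ) → Prop}
    (hp : ∀ w w' : List (Fin ℓ) → ℝ, (∀ ε, ε ≠ [] → w ε = w' ε) → p w → p w')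
    (h : ∀ᵐ w ∂(weightLaw ℓ ν), p fun ε => (w ε : ℝ)) :
    ∀ᵐ ω ∂P, p fun ε => X ε ω := by
  rw [← map_addRoot hX hlaw hind] at h
  have h1 := Measure.ae_ae_of_ae_prod (ae_of_ae_map (aemeasurable_addRoot hX) h)
  have h2 : ∀ᵐ ω ∂P, ∀ ε, ε ≠ [] → 0 ≤ X ε ω := by
    refine ae_all_iff.2 fun ε => ?_
    by_cases hε : ε = []
    · simp [hε]
    · simpa [hε] using hpos ε hε
  filter_upwards [h1, h2] with ω hω1 hω2
  obtain ⟨z, hz⟩ := hω1.exists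
  refine hp _ _ (fun ε hε => ?_) hz
  simp [addRoot, hε, hω2 ε hε]

end Transfer

section Law

variable {ℓ : ℕ} {ν : Measure ℝ≥0} [IsProbabilityMeasure ν]

lemma ae_measureReal_cascadeNN (hℓ : 2 ≤ ℓ) (hν : ∫⁻ x, (x : ℝ≥0∞) ∂ν = 1) :
    ∀ᵐ w : List (Fin ℓ) → ℝ≥0 ∂(weightLaw ℓ ν),
      (cascadeNN w : Measure ℝ).real (Set.Icc 0 1) = totalMass w := by
  filter_upwards [ae_cascadeNN hℓ hν] with w ⟨_, h2, h3⟩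
  have h4 := h3 []
  simp only [ival, pathProd_nil, List.length_nil, pow_zero, div_one, one_mul, shift_nil] at h4
  have h5 : (cascadeNN w : Measure ℝ) (Set.Icc 0 1) = (cascadeNN w : Measure ℝ) (Set.Ico 0 1) := by
    refine le_antisymm ?_ (measure_mono Set.Ico_subset_Icc_self)
    calc (cascadeNN w : Measure ℝ) (Set.Icc 0 1) ≤ (cascadeNN w : Measure ℝ) Set.univ :=
          measure_mono (Set.subset_univ _)
      _ = _ := by rw [← measure_add_measure_compl
        (measurableSet_Ico (a := (0 : ℝ)) (b := 1)), h2, add_zero]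
  rw [Measure.real, h5, h4, ENNReal.coe_toReal]

/-- The dimension of the cascade measure, on the product space. -/
lemma ae_dimension_cascadeNN (hℓ : 2 ≤ ℓ) (hν : ∫⁻ x, (x : ℝ≥0∞) ∂ν = 1)
    (hY1 : ∫ w : List (Fin ℓ) → ℝ≥0, (totalMass w : ℝ) ∂(weightLaw ℓ ν) = 1)
    (hYi : Integrable (fun w : List (Fin ℓ) → ℝ≥0 => (totalMass w : ℝ) * Real.log (totalMass w))
      (weightLaw ℓ ν)) {d : ℝ}
    (hd : d = 1 - (∫ x : ℝ≥0, (x : ℝ) * Real.log x ∂ν) / Real.log ℓ) :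
    ∀ᵐ w : List (Fin ℓ) → ℝ≥0 ∂(weightLaw ℓ ν), cascadeNN w ≠ 0 →
      (∃ E : Set ℝ, MeasurableSet E ∧ E ⊆ Set.Icc 0 1 ∧ (dimH E : EReal) = (d : EReal) ∧
        (cascadeNN w : Measure ℝ) (Set.Icc 0 1 \ E) = 0) ∧
      (∀ F : Set ℝ, F ⊆ Set.Icc 0 1 → (dimH F : EReal) < (d : EReal) →
        (cascadeNN w : Measure ℝ) F = 0) ∧
      (lowerDim (cascadeNN w : Measure ℝ) : EReal) = (d : EReal) ∧
      (upperDim (cascadeNN w : Measure ℝ) : EReal) = (d : EReal) := by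
  have hlog : 0 < Real.log ℓ := Real.log_pos (by exact_mod_cast hℓ)
  have hd0 : 0 ≤ d := by
    rw [hd, sub_nonneg, div_le_one hlog]
    exact (integrable_mul_log (by omega) hν hY1 hYi).2
  have hloc : ∀ᵐ w : List (Fin ℓ) → ℝ≥0 ∂(weightLaw ℓ ν), ∀ k : ℕ,
      ∀ᵐ x ∂(cascadeNN w : Measure ℝ), ∀ᶠ n : ℕ in atTop,
        ENNReal.ofReal ((ℓ : ℝ) ^ (-(n * (d + 1 / ((k : ℝ) + 1))))) ≤ cellMass ℓ (cascadeNN w) n x ∧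
        cellMass ℓ (cascadeNN w) n x ≤
          ENNReal.ofReal ((ℓ : ℝ) ^ (-(n * (d - 1 / ((k : ℝ) + 1))))) :=
    ae_all_iff.2 fun k => ae_cellMass_cascadeNN hℓ hν hY1 hYi (by positivity) hd
  filter_upwards [hloc, ae_cascadeNN hℓ hν] with w hw ⟨_, h2, _⟩ hne
  refine dimension_of_cellMass hℓ _ (measure_mono_null (Set.compl_subset_compl.2
    Set.Ico_subset_Icc_self) h2) (fun h => hne (Subtype.ext h)) hd0 fun δ hδ => ?_
  obtain ⟨k, hk⟩ := exists_nat_one_div_lt hδ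
  have hℓ1 : (1 : ℝ) ≤ ℓ := by exact_mod_cast (by omega : 1 ≤ ℓ)
  filter_upwards [hw k] with x hx
  filter_upwards [hx] with n ⟨hn1, hn2⟩
  constructor
  · exact le_trans (ENNReal.ofReal_le_ofReal (Real.rpow_le_rpow_of_exponent_le hℓ1
      (by gcongr))) hn1
  · exact hn2.trans (ENNReal.ofReal_le_ofReal (Real.rpow_le_rpow_of_exponent_le hℓ1
      (by gcongr)))

end Law

end MandelbrotCascade

open MandelbrotCascade

theorem mainTheorem9 {Ω : Type*} [MeasurableSpace Ω] (P : Measure Ω) [IsProbabilityMeasure P]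
    (ℓ : ℕ) (hℓ : 2 ≤ ℓ)
    -- the weight: a non-negative random variable with expectation one
    (W : Ω → ℝ) (hW : Integrable W P) (hW_nonneg : ∀ᵐ ω ∂P, 0 ≤ W ω) (hW_mean : ∫ ω, W ω ∂P = 1)
    -- independent copies of the weight, indexed by the non-empty finite words
    (X : List (Fin ℓ) → Ω → ℝ)
    (hX_copy : ∀ ε : List (Fin ℓ), ε ≠ [] → IdentDistrib (X ε) W P P)
    (hX_indep : iIndepFun (fun ε : {ε : List (Fin ℓ) // ε ≠ []} => X ε.1) P)
    -- the random cascade measure and its total mass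
    (m : Ω → FiniteMeasure ℝ) (hm : m = fun ω => MandelbrotCascade.cascade (fun ε => X ε ω))
    (Y : Ω → ℝ) (hY : Y = fun ω => (m ω : Measure ℝ).real (Set.Icc 0 1))
    -- `0 < E[Y log Y] < ∞`
    (hY_int : Integrable (fun ω => Y ω * Real.log (Y ω)) P)
    (hY_pos : 0 < ∫ ω, Y ω * Real.log (Y ω) ∂P)
    (d : ℝ) (hd : d = 1 - ∫ ω, W ω * Real.logb ℓ (W ω) ∂P) :
    (∀ᵐ ω ∂P, Tendsto (MandelbrotCascade.approx (fun ε => X ε ω)) atTop (𝓝 (m ω))) ∧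
    Integrable (fun ω => W ω * Real.logb ℓ (W ω)) P ∧
    ∀ᵐ ω ∂P, m ω ≠ 0 →
      (∃ E : Set ℝ, MeasurableSet E ∧ E ⊆ Set.Icc 0 1 ∧ (dimH E : EReal) = (d : EReal) ∧
        (m ω : Measure ℝ) (Set.Icc 0 1 \ E) = 0) ∧
      (∀ F : Set ℝ, F ⊆ Set.Icc 0 1 → (dimH F : EReal) < (d : EReal) →
        (m ω : Measure ℝ) F = 0) ∧
      (MandelbrotCascade.lowerDim (m ω : Measure ℝ) : EReal) = (d : EReal) ∧
      (MandelbrotCascade.upperDim (m ω : Measure ℝ) : EReal) = (d : EReal) := by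
  have hWm : AEMeasurable W P := hW.aemeasurable
  set ν : Measure ℝ≥0 := P.map fun ω => (W ω).toNNReal with hνdef
  have hWm' : AEMeasurable (fun ω => (W ω).toNNReal) P := hWm.real_toNNReal
  have : IsProbabilityMeasure ν := Measure.isProbabilityMeasure_map hWm'
  have hν : ∫⁻ x, (x : ℝ≥0∞) ∂ν = 1 := by
    rw [hνdef, lintegral_map' measurable_coe_nnreal_ennreal.aemeasurable hWm']
    have := ofReal_integral_eq_lintegral_ofReal hW hW_nonneg
    rw [hW_mean, ENNReal.ofReal_one] at this
    exact this.symm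
  have hXm : ∀ ε, ε ≠ [] → AEMeasurable (X ε) P := fun ε hε => (hX_copy ε hε).aemeasurable_fst
  have hlaw : ∀ ε, ε ≠ [] → P.map (fun ω => (X ε ω).toNNReal) = ν := fun ε hε =>
    ((hX_copy ε hε).comp measurable_real_toNNReal).map_eq
  have hpos : ∀ ε, ε ≠ [] → ∀ᵐ ω ∂P, 0 ≤ X ε ω := fun ε hε =>
    (hX_copy ε hε).symm.ae_snd measurableSet_Ici hW_nonneg
  have hℓ0 : 0 < ℓ := by omega
  -- the total mass of the cascade is the limit of the martingale of total masses
  have hYeq : ∀ᵐ ω ∂P, Y ω = totalMass fun ε => (X ε ω).toNNReal := by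
    have := ae_of_ae_weightLaw hXm hlaw hX_indep hpos (p := fun w =>
      (cascade w : Measure ℝ).real (Set.Icc 0 1) = totalMass fun ε => (w ε).toNNReal)
      (fun w w' h hw => by
        rw [← cascade_congr h, hw, totalMass_congr fun ε hε => by rw [h ε hε]])
      (by simpa using ae_measureReal_cascadeNN hℓ hν)
    simpa only [hY, hm] using this
  have hYi : Integrable (fun w : List (Fin ℓ) → ℝ≥0 => (totalMass w : ℝ) * Real.log (totalMass w))
      (weightLaw ℓ ν) := by
    have hmeas : Measurable fun w : List (Fin ℓ) → ℝ≥0 =>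
        (totalMass w : ℝ) * Real.log (totalMass w) :=
      measurable_totalMass.coe_nnreal_real.mul measurable_totalMass.coe_nnreal_real.log
    rw [← map_addRoot hXm hlaw hX_indep, integrable_map_measure hmeas.aestronglyMeasurable
      (aemeasurable_addRoot hXm)]
    refine (hY_int.comp_fst ν).congr ?_
    filter_upwards [Measure.quasiMeasurePreserving_fst.ae hYeq] with x hx
    have : totalMass (addRoot X x) = totalMass fun ε => (X ε x.1).toNNReal :=
      totalMass_congr fun ε hε => by simp [addRoot, hε]
    rw [hx, Function.comp_apply, this]
  -- `Y` is not almost surely zero, since otherwise `E[Y log Y]` would vanish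
  have hne : ¬ ∀ᵐ w ∂(weightLaw ℓ ν), totalMass w = 0 := by
    intro h
    have h1 := ae_of_ae_weightLaw hXm hlaw hX_indep hpos (p := fun w =>
      totalMass (fun ε => (w ε).toNNReal) = 0)
      (fun w w' h hw => (totalMass_congr fun ε hε => by rw [h ε hε]).symm.trans hw)
      (by simpa using h)
    have h2 : ∫ ω, Y ω * Real.log (Y ω) ∂P = 0 := by
      refine integral_eq_zero_of_ae ?_
      filter_upwards [hYeq, h1] with ω hω1 hω2
      simp [hω1, hω2]
    exact hY_pos.ne' h2
  have hY1 := integral_totalMass_eq_one hℓ0 hν hne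
  have hWlog := (integrable_mul_log hℓ0 hν hY1 hYi).1
  have hlogm : Measurable fun x : ℝ≥0 => (x : ℝ) * Real.log x := by fun_prop
  have hWae : (fun ω => W ω * Real.logb ℓ (W ω)) =ᵐ[P]
      fun ω => (((W ω).toNNReal : ℝ) * Real.log (W ω).toNNReal) / Real.log ℓ := by
    filter_upwards [hW_nonneg] with ω hω
    rw [Real.coe_toNNReal _ hω, Real.logb, mul_div_assoc]
  have hd' : d = 1 - (∫ x : ℝ≥0, (x : ℝ) * Real.log x ∂ν) / Real.log ℓ := by
    rw [hd, integral_congr_ae hWae, integral_div, hνdef,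
      integral_map hWm' hlogm.aestronglyMeasurable]
  have hmain := ae_of_ae_weightLaw hXm hlaw hX_indep hpos (p := fun w =>
    Tendsto (approx w) atTop (𝓝 (cascade w)) ∧ (cascade w ≠ 0 →
      (∃ E : Set ℝ, MeasurableSet E ∧ E ⊆ Set.Icc 0 1 ∧ (dimH E : EReal) = (d : EReal) ∧
        (cascade w : Measure ℝ) (Set.Icc 0 1 \ E) = 0) ∧
      (∀ F : Set ℝ, F ⊆ Set.Icc 0 1 → (dimH F : EReal) < (d : EReal) →
        (cascade w : Measure ℝ) F = 0) ∧
      (lowerDim (cascade w : Measure ℝ) : EReal) = (d : EReal) ∧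
      (upperDim (cascade w : Measure ℝ) : EReal) = (d : EReal)))
    (fun w w' h hw => by rwa [← approx_congr h, ← cascade_congr h])
    (by
      filter_upwards [ae_cascadeNN hℓ hν, ae_dimension_cascadeNN hℓ hν hY1 hYi hd']
        with w hw1 hw2
      exact ⟨hw1.1, hw2⟩)
  subst hm
  refine ⟨hmain.mono fun ω h => h.1, ?_, hmain.mono fun ω h => h.2⟩
  refine Integrable.congr ?_ hWae.symm
  exact ((integrable_map_measure hlogm.aestronglyMeasurable hWm').1 hWlog).div_const _
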